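/- Let $\mathbb H=L^2((0,1);\mathbb R)$ and $E=\mathcal C([0,1];\mathbb R)$ with the supremum norm $\|\cdot\|_E$. For $k\ge 1$ let $\lambda_k=k^2\pi^2$ and $e_k(\xi)=\sqrt2\sin(k\pi\xi)$; let $A$ be the Dirichlet Laplacian $Ax=-x''$ on $(0,1)$, so that $Ae_k=\lambda_ke_k$, $A^{-1}x=\sum_k\lambda_k^{-1}\langle x,e_k\rangle e_k$, and let $S(t)x=\sum_k e^{-\lambda_kt}\langle x,e_k\rangle e_k$ for $x\in\mathbb H$, $t\ge 0$. Let $H\in(1/4,1/2)\cup(1/2,1)$ and let $(\beta_k^H)_{k\ge1}$ be independent real fractional Brownian motions with Hurst index $H$ on a probability space $(\Omega,\mathcal F,\mathbb P)$ (centred Gaussian processes with covariance $\frac12(t^{2H}+s^{2H}-|t-s|^{2H})$), and let $B^H(t)=\sum_k\beta^H_k(t)e_k$ be the associated cylindrical fractional Brownian motion. Let $f:\mathbb R\to\mathbb R$ be such that for some $L_f\ge0$ and some $q\in\mathbb N$, for all $z_1,z_2\in\mathbb R$, \[(z_2-z_1)(f(z_2)-f(z_1))\le L_f(z_2-z_1)^2,\qquad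 |f(z_2)-f(z_1)|\le L_f(1+|z_1|^{2q}+|z_2|^{2q})|z_2-z_1|,\] and let $g:\mathbb R\to\mathbb R$ be globally Lipschitz continuous. Let $\phi_s(z)$, $s\ge0$, be the flow of the ordinary differential equation $\dot z_s=f(z_s)$, $z_0=z$, and for $x\in E$ set $\Phi_s(x)(\xi)=\phi_s(x(\xi))$, $G(x)(\xi)=g(x(\xi))$. Given $T\in(0,\infty)$, $N\in\mathbb N$ with $N\ge 1$, $\Delta t=T/N$, $t_n=n\Delta t$ and $x_0\in E$, consider the scheme $X_0=x_0$ and, for $n=0,\dots,N-1$, \[X_{n+1}=S(\Delta t)\Phi_{\Delta t}(X_n)+A^{-1}(I-S(\Delta t))G(X_n)+S(\Delta t)\bigl(B^H(t_{n+1})-B^H(t_n)\bigr),\] where $S(\Delta t)\bigl(B^H(t_{n+1})-B^H(t_n)\bigr)=\sum_k(\beta^H_k(t_{n+1})-\beta^H_k(t_n))S(\Delta t)e_k$, the series converging in $\mathbb H$ almost surely. Then the scheme has an $E$-valued solution $(X_n)_{0\le n\le N}$, and every such solution satisfies the following moment bounds: for all $p\in\mathbb N$ with $p\ge1$ and all $T\in(0,\infty)$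 there exist positive real numbers $C_{p,H}(T,r)$, $r\ge 0$ (depending also on $f$ and $g$, but neither on $x_0$, $N$, $\Delta t$ nor on the probability space), such that for all $x_0\in E$ and all $\Delta t=T/N$ with $N\ge1$, the random variables $X_0,\dots,X_N$ belong to $L^p(\Omega;E)$ and \[\sup_{n=0,\ldots,N}\bigl(\mathbb E[\|X_n\|_E^p]\bigr)^{1/p}\le C_{p,H}(T,\|x_0\|_E).\] -/

import Mathlib

open MeasureTheory ProbabilityTheory Set
open scoped NNReal ENNReal unitInterval

noncomputable section

namespace SplittingScheme

/-- The Hilbert space `L²((0,1); ℝ)` (the endpoints of `[0,1]` have measure zero). -/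
abbrev L2Space : Type := Lp ℝ 2 (volume : Measure I)

/-- The Banach space `C([0,1]; ℝ)` with the supremum norm. -/
abbrev CSpace : Type := C(I, ℝ)

/-- The canonical embedding of `C([0,1]; ℝ)` into `L²((0,1); ℝ)`. -/
def embed : CSpace →L[ℝ] L2Space := ContinuousMap.toLp 2 (volume : Measure I) ℝ

/-- Eigenvalues `(jπ)²`, `j = 1, 2, …`, of the Dirichlet Laplacian; the index `k : ℕ` stands for
`j = k + 1`. -/
def eigenvalue (k : ℕ) : ℝ := (((k : ℝ) + 1) * Real.pi) ^ 2

/-- Eigenfunctions `ξ ↦ √2 sin(jπξ)`, `j = k + 1`, as continuous functions. -/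
def eigenfunction (k : ℕ) : CSpace where
  toFun ξ := Real.sqrt 2 * Real.sin (((k : ℝ) + 1) * Real.pi * (ξ : ℝ))
  continuous_toFun := by fun_prop

/-- The same eigenfunctions as elements of `L²((0,1); ℝ)`. -/
def basisVec (k : ℕ) : L2Space := embed (eigenfunction k)

/-- The semigroup `S(t) x = ∑ₖ exp(-λₖ t) ⟨x, eₖ⟩ eₖ` generated by `-A` on `L²((0,1); ℝ)`. -/
def semigroup (t : ℝ) (x : L2Space) : L2Space :=
  ∑' k : ℕ, (Real.exp (-eigenvalue k * t) * inner ℝ (basisVec k) x) • basisVec k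

/-- The bounded inverse `A⁻¹ x = ∑ₖ λₖ⁻¹ ⟨x, eₖ⟩ eₖ` of the Dirichlet Laplacian. -/
def invA (x : L2Space) : L2Space :=
  ∑' k : ℕ, ((eigenvalue k)⁻¹ * inner ℝ (basisVec k) x) • basisVec k

/-- One-sided Lipschitz continuity together with local Lipschitz continuity with polynomially
growing constant. -/
def IsOneSidedLipschitz (f : ℝ → ℝ) : Prop :=
  ∃ L : ℝ, 0 ≤ L ∧
    (∀ z₁ z₂ : ℝ, (z₂ - z₁) * (f z₂ - f z₁) ≤ L * (z₂ - z₁) ^ 2) ∧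
    ∃ q : ℕ, ∀ z₁ z₂ : ℝ,
      |f z₂ - f z₁| ≤ L * (1 + |z₁| ^ (2 * q) + |z₂| ^ (2 * q)) * |z₂ - z₁|

/-- Global Lipschitz continuity. -/
def IsGloballyLipschitz (g : ℝ → ℝ) : Prop :=
  ∃ L : ℝ, 0 ≤ L ∧ ∀ z₁ z₂ : ℝ, |g z₂ - g z₁| ≤ L * |z₂ - z₁|

/-- `u` solves `u' = f(u)` on `[0, ∞)` with `u(0) = z`. -/
def IsTrajectory (f : ℝ → ℝ) (z : ℝ) (u : ℝ → ℝ) : Prop :=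
  u 0 = z ∧ ∀ s : ℝ, 0 ≤ s → HasDerivWithinAt u (f (u s)) (Ici 0) s

open Classical in
/-- The flow `φ_s(z)` of `u' = f(u)` for `s ≥ 0`. The default value `z` is never used when `f` is
one-sided Lipschitz in the above sense, since a unique global forward solution then exists. -/
def flow (f : ℝ → ℝ) (s z : ℝ) : ℝ :=
  if h : ∃ u : ℝ → ℝ, IsTrajectory f z u then h.choose s else z

open Classical in
/-- The superposition operator `x ↦ (ξ ↦ h(x(ξ)))` on `C([0,1]; ℝ)` of a continuous function `h`
(the default value is never used for a continuous `h`). -/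
def superposition (h : ℝ → ℝ) (x : CSpace) : CSpace :=
  if hc : Continuous h then (⟨h, hc⟩ : C(ℝ, ℝ)).comp x else 0

/-- Real-valued fractional Brownian motion on `[0, ∞)` with Hurst index `H`. -/
structure IsFBM {Ω : Type*} [MeasurableSpace Ω] (H : ℝ) (β : ℝ≥0 → Ω → ℝ) (P : Measure Ω) :
    Prop where
  measurable : ∀ t, Measurable (β t)
  gaussian : IsGaussianProcess β P
  mean : ∀ t, ∫ ω, β t ω ∂P = 0
  covariance : ∀ t s, ∫ ω, β t ω * β s ω ∂P =
    (1 / 2) * ((t : ℝ) ^ (2 * H) + (s : ℝ) ^ (2 * H) - |(t : ℝ) - (s : ℝ)| ^ (2 * H))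

/-- A sequence of independent real-valued fractional Brownian motions with Hurst index `H`: the
coordinates of a cylindrical fractional Brownian motion `B^H(t) = ∑ₖ βₖ(t) eₖ`. -/
structure IsCylindricalFBM {Ω : Type*} [MeasurableSpace Ω] (H : ℝ) (β : ℕ → ℝ≥0 → Ω → ℝ)
    (P : Measure Ω) : Prop where
  fbm : ∀ k, IsFBM H (β k) P
  indep : iIndepFun (fun k ω t => β k t ω) P

/-- `V = S(r) (B^H(t) - B^H(s))` at the sample point `ω`, i.e. `V` is the sum of the series
`∑ₖ (βₖ(t) - βₖ(s)) S(r) eₖ`, which has to converge in `L²((0,1); ℝ)`. -/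
def IsSmoothedIncrement {Ω : Type*} (β : ℕ → ℝ≥0 → Ω → ℝ) (r : ℝ) (s t : ℝ≥0) (ω : Ω)
    (V : L2Space) : Prop :=
  HasSum (fun k : ℕ => (β k t ω - β k s ω) • semigroup r (basisVec k)) V

/-- The process `X 0, …, X N` with values in `C([0,1]; ℝ)` solves, almost surely, the splitting
scheme with step size `dt`, i.e. `X 0 = x₀` and
`X (n+1) = S(dt) Φ_dt(X n) + A⁻¹ (I - S(dt)) G(X n) + S(dt) (B^H((n+1) dt) - B^H(n dt))`. -/
structure IsNumericalSolution {Ω : Type*} [MeasurableSpace Ω] (f g : ℝ → ℝ) (dt : ℝ≥0) (N : ℕ)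
    (x₀ : CSpace) (β : ℕ → ℝ≥0 → Ω → ℝ) (P : Measure Ω) (X : ℕ → Ω → CSpace) : Prop where
  init : ∀ᵐ ω ∂P, X 0 ω = x₀
  step : ∀ n < N, ∀ᵐ ω ∂P, ∃ V : L2Space,
    IsSmoothedIncrement β dt ((n : ℝ≥0) * dt) (((n + 1 : ℕ) : ℝ≥0) * dt) ω V ∧
    embed (X (n + 1) ω) =
      semigroup dt (embed (superposition (flow f dt) (X n ω))) +
      invA (embed (superposition g (X n ω)) - semigroup dt (embed (superposition g (X n ω)))) +
      V

end SplittingScheme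

end

noncomputable section

namespace SplittingScheme

/-! The noise is removed by subtracting the discrete stochastic convolution Z, defined by Z₀ = 0 and
Zₙ₊₁ = S(Δt)Zₙ + S(Δt)(increment of B^H). The difference Xₙ₊₁ − Zₙ₊₁ equals S(Δt)(Φ(Xₙ) − Zₙ) +
A⁻¹(I − S(Δt))G(Xₙ). In the supremum norm S(t) is a contraction (`norm_heat_le`) and A⁻¹(I − S(t))
has norm at most t (`norm_integratedHeat_le`). The flow is e^{Lt}-Lipschitz and moves z by at most
tK(1 + |z|)^m (`exists_flow_bounds`). Hence yₙ = ‖Xₙ − Zₙ‖ satisfies yₙ₊₁ ≤ e^{cΔt}yₙ + ΔtK(1 +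
‖Zₙ‖)^m, and a discrete Grönwall argument (`norm_le_of_recursion`) reduces the theorem to moments of
‖Zₙ‖ of order pm, uniform in n and Δt.

The k-th coefficient of Zₙ is a centred Gaussian. Summation by parts (`discreteConv_eq_sum`)
expresses it through the differences β(tₙ) − β(tₙ₋ᵢ), whose L² norms are (iΔt)^H. The triangle
inequality and `discreteConv_weights_le` then bound its L² norm by 6λₖ^{-H}, hence by 6k^{-2H}.
Correlations of increments never enter, so H < 1/2 and H > 1/2 are treated alike.

The coefficients are independent in k. The supremum norm is estimated on dyadic blocks
(`eLpNorm_dyadicBlock_le`): the block of frequencies near 2^m is controlled on a grid of mesh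
4^{-m}, at the price of a factor 4^{m/r} in L^r. For large r the block bounds form a convergent
geometric series because 2H > 1/2; this is where H > 1/4 is needed.

The scheme is an identity in L². Injectivity of the embedding of continuous functions turns it
almost surely into an explicit recursion in C([0,1]) (`step_iff`), which yields existence and covers
every solution. -/

/-! ### The sine basis and the embedding of C([0,1]) into L². -/

lemma integral_unitInterval (f : ℝ → ℝ) : ∫ x : I, f x = ∫ x in (0 : ℝ)..1, f x := by
  rw [Measure.Subtype.volume_def, integral_subtype_comap measurableSet_Icc,
    integral_Icc_eq_integral_Ioc, intervalIntegral.integral_of_le zero_le_one]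

lemma integral_cos_int_mul_pi (m : ℤ) (hm : m ≠ 0) :
    ∫ x : I, Real.cos ((m : ℝ) * Real.pi * (x : ℝ)) = 0 := by
  have hm' : (m : ℝ) * Real.pi ≠ 0 := mul_ne_zero (by exact_mod_cast hm) Real.pi_ne_zero
  rw [integral_unitInterval (fun x => Real.cos ((m : ℝ) * Real.pi * x)),
    intervalIntegral.integral_comp_mul_left (fun x => Real.cos x) hm']
  simp [Real.sin_int_mul_pi]

/-- Two different points are allowed because the formula serves both orthonormality and the
reflection formula for the Dirichlet kernel. -/
lemma eigenfunction_mul (j k : ℕ) (ξ η : ℝ) :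
    Real.sqrt 2 * Real.sin (((j : ℝ) + 1) * Real.pi * ξ) *
      (Real.sqrt 2 * Real.sin (((k : ℝ) + 1) * Real.pi * η)) =
    Real.cos (((j : ℝ) + 1) * Real.pi * ξ - ((k : ℝ) + 1) * Real.pi * η) -
      Real.cos (((j : ℝ) + 1) * Real.pi * ξ + ((k : ℝ) + 1) * Real.pi * η) := by
  have h2 : Real.sqrt 2 * Real.sqrt 2 = 2 := Real.mul_self_sqrt (by norm_num)
  rw [Real.cos_sub, Real.cos_add]
  linear_combination Real.sin (((j : ℝ) + 1) * Real.pi * ξ) *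
    Real.sin (((k : ℝ) + 1) * Real.pi * η) * h2

lemma integrable_of_continuous {f : I → ℝ} (hf : Continuous f) : Integrable f :=
  hf.integrable_of_hasCompactSupport (HasCompactSupport.of_compactSpace f)

lemma inner_embed (x y : CSpace) : inner ℝ (embed x) (embed y) = ∫ η : I, x η * y η := by
  rw [embed, ContinuousMap.inner_toLp]
  simp [mul_comm]

lemma inner_basisVec (j k : ℕ) :
    inner ℝ (basisVec j) (basisVec k) = if j = k then (1 : ℝ) else 0 := by
  rw [basisVec, basisVec, inner_embed]
  have h : ∀ η : I, eigenfunction j η * eigenfunction k η =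
      Real.cos ((((j : ℤ) - k : ℤ) : ℝ) * Real.pi * (η : ℝ)) -
      Real.cos ((((j : ℤ) + k + 2 : ℤ) : ℝ) * Real.pi * (η : ℝ)) := by
    intro η
    refine (eigenfunction_mul j k η η).trans ?_
    push_cast
    congr 2 <;> ring
  simp_rw [h]
  rw [integral_sub (integrable_of_continuous (by fun_prop))
    (integrable_of_continuous (by fun_prop)),
    integral_cos_int_mul_pi ((j : ℤ) + k + 2) (by omega)]
  split_ifs with hjk
  · simp [hjk]
  · rw [integral_cos_int_mul_pi _ (by omega)]; simp

lemma norm_basisVec (k : ℕ) : ‖basisVec k‖ = 1 := by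
  have h := real_inner_self_eq_norm_sq (basisVec k)
  rw [inner_basisVec, if_pos rfl] at h
  nlinarith [norm_nonneg (basisVec k)]

lemma norm_embed_le (x : CSpace) : ‖embed x‖ ≤ ‖x‖ := by
  refine (embed.le_opNorm x).trans (mul_le_of_le_one_left (norm_nonneg x) ?_)
  refine (ContinuousMap.toLp_norm_le (p := 2) (𝕜 := ℝ) (E := ℝ) (volume : Measure I)).trans ?_
  simp [measureUnivNNReal]

/-- Makes `embed` injective, so that identities in L² can be read as identities of continuous
functions. -/
instance isOpenPosMeasure_unitInterval : (volume : Measure I).IsOpenPosMeasure where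
  open_pos U hU hne := by
    obtain ⟨a, b, hab, h⟩ := hU.exists_Ioo_subset hne
    refine fun h0 => (measure_mono_null h h0).not_gt ?_
    rw [unitInterval.volume_Ioo, ENNReal.ofReal_pos, sub_pos]
    exact hab

lemma embed_injective : Function.Injective embed :=
  ContinuousMap.toLp_injective (volume : Measure I)

lemma norm_eigenfunction_le (k : ℕ) : ‖eigenfunction k‖ ≤ Real.sqrt 2 := by
  rw [ContinuousMap.norm_le _ (Real.sqrt_nonneg 2)]
  intro ξ
  change |Real.sqrt 2 * Real.sin _| ≤ _
  rw [abs_mul, abs_of_nonneg (Real.sqrt_nonneg 2)]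
  exact mul_le_of_le_one_right (Real.sqrt_nonneg 2) (Real.abs_sin_le_one _)

lemma abs_eigenfunction_apply_le (k : ℕ) (ξ : I) : |eigenfunction k ξ| ≤ Real.sqrt 2 :=
  ((eigenfunction k).norm_coe_le_norm ξ).trans (norm_eigenfunction_le k)

/-! ### Fourier coefficients and summability over the spectrum. -/

/-- The Fourier coefficient `⟨x, eₖ⟩` of a continuous function. -/
def coeff (k : ℕ) (x : CSpace) : ℝ := inner ℝ (basisVec k) (embed x)

lemma coeff_eq_integral (k : ℕ) (x : CSpace) :
    coeff k x = ∫ η : I, eigenfunction k η * x η := inner_embed _ _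

lemma abs_coeff_le (k : ℕ) (x : CSpace) : |coeff k x| ≤ ‖x‖ := by
  refine (abs_real_inner_le_norm _ _).trans ?_
  rw [norm_basisVec, one_mul]
  exact norm_embed_le x

lemma coeff_sub (k : ℕ) (x y : CSpace) : coeff k (x - y) = coeff k x - coeff k y := by
  simp [coeff, inner_sub_right]

lemma eigenvalue_pos (k : ℕ) : 0 < eigenvalue k := by
  unfold eigenvalue
  have := Real.pi_pos
  positivity

lemma sq_le_eigenvalue (k : ℕ) : ((k : ℝ) + 1) ^ 2 ≤ eigenvalue k := by
  unfold eigenvalue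
  have := Real.pi_gt_three
  have hk : (0 : ℝ) ≤ k := k.cast_nonneg
  gcongr
  nlinarith

lemma summable_inv_eigenvalue : Summable fun k : ℕ => (eigenvalue k)⁻¹ := by
  have h : Summable fun k : ℕ => ((((k + 1 : ℕ) : ℝ)) ^ 2)⁻¹ :=
    (summable_nat_add_iff 1).2 (Real.summable_nat_pow_inv.2 one_lt_two)
  refine h.of_nonneg_of_le (fun k => inv_nonneg.2 (eigenvalue_pos k).le) fun k => ?_
  push_cast
  exact inv_anti₀ (by positivity) (sq_le_eigenvalue k)

lemma exp_neg_eigenvalue_le {t : ℝ} (ht : 0 < t) (k : ℕ) :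
    Real.exp (-eigenvalue k * t) ≤ t⁻¹ * (eigenvalue k)⁻¹ := by
  rw [neg_mul, Real.exp_neg, ← mul_inv, mul_comm t]
  have := mul_pos (eigenvalue_pos k) ht
  exact inv_anti₀ this (by linarith [Real.add_one_le_exp (eigenvalue k * t)])

lemma summable_exp_neg_eigenvalue {t : ℝ} (ht : 0 < t) :
    Summable fun k : ℕ => Real.exp (-eigenvalue k * t) :=
  (summable_inv_eigenvalue.mul_left t⁻¹).of_nonneg_of_le (fun _ => (Real.exp_pos _).le)
    (exp_neg_eigenvalue_le ht)

/-! ### Absolutely convergent sine series and the heat semigroup. -/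

/-- The sum of the sine series with coefficients `a`, as a continuous function. -/
def sineSeries (a : ℕ → ℝ) : CSpace := ∑' k, a k • eigenfunction k

lemma hasSum_sineSeries {a : ℕ → ℝ} (ha : Summable fun k => |a k|) :
    HasSum (fun k => a k • eigenfunction k) (sineSeries a) := by
  refine (Summable.of_norm_bounded (ha.mul_right (Real.sqrt 2)) fun k => ?_).hasSum
  rw [norm_smul, Real.norm_eq_abs]
  exact mul_le_mul_of_nonneg_left (norm_eigenfunction_le k) (abs_nonneg _)

lemma hasSum_embed_sineSeries {a : ℕ → ℝ} (ha : Summable fun k => |a k|) :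
    HasSum (fun k => a k • basisVec k) (embed (sineSeries a)) := by
  simpa [basisVec] using (hasSum_sineSeries ha).mapL embed

lemma coeff_sineSeries {a : ℕ → ℝ} (ha : Summable fun k => |a k|) (k : ℕ) :
    coeff k (sineSeries a) = a k := by
  have h := (hasSum_embed_sineSeries ha).mapL (innerSL ℝ (basisVec k))
  simp only [map_smul, innerSL_apply_apply, inner_basisVec, smul_eq_mul, mul_ite, mul_one,
    mul_zero] at h
  refine h.unique ?_
  have h2 := hasSum_single (f := fun j => if k = j then a j else 0) k fun j hj => if_neg hj.symm
  simpa using h2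

lemma sineSeries_add {a b : ℕ → ℝ} (ha : Summable fun k => |a k|)
    (hb : Summable fun k => |b k|) :
    sineSeries (fun k => a k + b k) = sineSeries a + sineSeries b := by
  have h := (hasSum_sineSeries ha).add (hasSum_sineSeries hb)
  simp only [← add_smul] at h
  exact h.tsum_eq

/-- The heat semigroup with Dirichlet boundary conditions on continuous functions. -/
def heat (t : ℝ) (x : CSpace) : CSpace :=
  sineSeries fun k => Real.exp (-eigenvalue k * t) * coeff k x

lemma summable_heat {t : ℝ} (ht : 0 < t) (x : CSpace) :
    Summable fun k => |Real.exp (-eigenvalue k * t) * coeff k x| := by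
  refine ((summable_exp_neg_eigenvalue ht).mul_right ‖x‖).of_nonneg_of_le
    (fun _ => abs_nonneg _) fun k => ?_
  rw [abs_mul, Real.abs_exp]
  exact mul_le_mul_of_nonneg_left (abs_coeff_le k x) (Real.exp_pos _).le

lemma embed_heat {t : ℝ} (ht : 0 < t) (x : CSpace) : embed (heat t x) = semigroup t (embed x) :=
  (hasSum_embed_sineSeries (summable_heat ht x)).tsum_eq.symm

lemma heat_sub {t : ℝ} (ht : 0 < t) (x y : CSpace) : heat t (x - y) = heat t x - heat t y := by
  have h := (hasSum_sineSeries (summable_heat ht x)).sub (hasSum_sineSeries (summable_heat ht y))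
  simp only [← sub_smul, ← mul_sub, ← coeff_sub] at h
  exact h.tsum_eq

lemma heat_sineSeries (t : ℝ) {a : ℕ → ℝ} (ha : Summable fun k => |a k|) :
    heat t (sineSeries a) = sineSeries fun k => Real.exp (-eigenvalue k * t) * a k := by
  simp only [heat, coeff_sineSeries ha]

lemma semigroup_basisVec (t : ℝ) (k : ℕ) :
    semigroup t (basisVec k) = Real.exp (-eigenvalue k * t) • basisVec k := by
  rw [semigroup, tsum_eq_single k]
  · rw [inner_basisVec, if_pos rfl, mul_one]
  · intro j hj
    simp [inner_basisVec, hj]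

/-! ### Theta functions, the heat kernel and the supremum-norm contraction. -/

/-- The sign is invisible in the cosine series. The functional equation (Poisson summation) turns it
into a positive multiple of a series of real exponentials. -/
lemma cosKernel_nonneg (a : UnitAddCircle) {t : ℝ} (ht : 0 < t) :
    0 ≤ HurwitzZeta.cosKernel a t := by
  induction a using QuotientAddGroup.induction_on with
  | H a =>
    have h1 := HurwitzZeta.evenKernel_functional_equation (a : UnitAddCircle) (1 / t)
    rw [one_div_one_div] at h1
    have h2 : 0 ≤ HurwitzZeta.evenKernel (a : UnitAddCircle) (1 / t) :=
      (HurwitzZeta.hasSum_int_evenKernel a (one_div_pos.2 ht)).nonneg fun _ => (Real.exp_pos _).le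
    rw [h1] at h2
    exact nonneg_of_mul_nonneg_right h2 (by positivity)

/-- The theta function `1 + ∑ₖ 2 exp(-λₖ t) cos(kπa)`. -/
def theta (t a : ℝ) : ℝ := HurwitzZeta.cosKernel ((a / 2 : ℝ) : UnitAddCircle) (Real.pi * t)

lemma theta_nonneg {t : ℝ} (ht : 0 < t) (a : ℝ) : 0 ≤ theta t a :=
  cosKernel_nonneg _ (mul_pos Real.pi_pos ht)

lemma hasSum_of_eq {f g : ℕ → ℝ} {a b : ℝ} (h : HasSum f a) (hf : ∀ k, g k = f k) (ha : b = a) :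
    HasSum g b := by
  rw [ha, funext hf]
  exact h

lemma hasSum_theta {t : ℝ} (ht : 0 < t) (a : ℝ) :
    HasSum (fun k : ℕ => 2 * Real.cos (((k : ℝ) + 1) * Real.pi * a) * Real.exp (-eigenvalue k * t))
      (theta t a - 1) := by
  have h := HurwitzZeta.hasSum_nat_cosKernel₀ (a / 2) (mul_pos Real.pi_pos ht)
  refine hasSum_of_eq h (fun k => ?_) rfl
  unfold eigenvalue
  congr 2 <;> [congr 1; skip] <;> ring

lemma continuous_theta {t : ℝ} (ht : 0 < t) : Continuous (theta t) := by
  have h : Continuous fun a : ℝ => ∑' k : ℕ,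
      2 * Real.cos (((k : ℝ) + 1) * Real.pi * a) * Real.exp (-eigenvalue k * t) := by
    refine continuous_tsum (fun k => by fun_prop)
      ((summable_exp_neg_eigenvalue ht).mul_left 2) fun k a => ?_
    rw [norm_mul, norm_mul, Real.norm_eq_abs, Real.norm_eq_abs, Real.norm_eq_abs, Real.abs_exp]
    have := Real.abs_cos_le_one (((k : ℝ) + 1) * Real.pi * a)
    have := Real.exp_pos (-eigenvalue k * t)
    rw [abs_of_pos (by norm_num : (0 : ℝ) < 2)]
    gcongr
    linarith
  have h2 : theta t = fun a => (∑' k : ℕ,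
      2 * Real.cos (((k : ℝ) + 1) * Real.pi * a) * Real.exp (-eigenvalue k * t)) + 1 := by
    ext a
    rw [(hasSum_theta ht a).tsum_eq]; ring
  rw [h2]
  exact h.add continuous_const

/-- Method of images: the Dirichlet kernel is the difference of the periodic heat kernel and its
reflection. -/
lemma hasSum_dirichletKernel {t : ℝ} (ht : 0 < t) (ξ η : I) :
    HasSum (fun k : ℕ => Real.exp (-eigenvalue k * t) * (eigenfunction k ξ * eigenfunction k η))
      ((theta t (ξ - η) - theta t (ξ + η)) / 2) := by
  have h := ((hasSum_theta ht (ξ - η)).sub (hasSum_theta ht (ξ + η))).div_const 2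
  refine hasSum_of_eq h (fun k => ?_) (by ring)
  · have := eigenfunction_mul k k ξ η
    rw [show eigenfunction k ξ * eigenfunction k η = _ from this]
    rw [mul_sub (((k : ℝ) + 1) * Real.pi), mul_add (((k : ℝ) + 1) * Real.pi)]
    ring

/-- Replacing the difference by the sum of the two theta terms gives the Neumann kernel, which
dominates the Dirichlet kernel in absolute value. Its mass is one since every cosine mode except the
constant integrates to zero. -/
lemma integral_neumannKernel {t : ℝ} (ht : 0 < t) (ξ : I) :
    ∫ η : I, (theta t (ξ - η) + theta t (ξ + η)) / 2 = 1 := by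
  have key : HasSum (fun k : ℕ => ∫ η : I, Real.exp (-eigenvalue k * t) *
      (2 * Real.cos (((k : ℝ) + 1) * Real.pi * ξ) * Real.cos (((k : ℝ) + 1) * Real.pi * η)))
      (∫ η : I, ((theta t (ξ - η) + theta t (ξ + η)) / 2 - 1)) := by
    refine hasSum_integral_of_dominated_convergence
      (fun k _ => Real.exp (-eigenvalue k * t) * 2)
      (fun k => (by fun_prop : Continuous _).aestronglyMeasurable) (fun k => .of_forall fun η => ?_)
      (.of_forall fun _ => (summable_exp_neg_eigenvalue ht).mul_right 2)
      (integrable_const _) (.of_forall fun η => ?_)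
    · rw [norm_mul, norm_mul, norm_mul]
      simp only [Real.norm_eq_abs, Real.abs_exp, Nat.abs_ofNat]
      have h1 := Real.abs_cos_le_one (((k : ℝ) + 1) * Real.pi * ξ)
      have h2 := Real.abs_cos_le_one (((k : ℝ) + 1) * Real.pi * η)
      gcongr
      nlinarith [abs_nonneg (Real.cos (((k : ℝ) + 1) * Real.pi * η)),
        abs_nonneg (Real.cos (((k : ℝ) + 1) * Real.pi * ξ))]
    · have h := ((hasSum_theta ht (ξ - η)).add (hasSum_theta ht (ξ + η))).div_const 2
      refine hasSum_of_eq h (fun k => ?_) (by ring)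
      rw [mul_sub (((k : ℝ) + 1) * Real.pi), mul_add (((k : ℝ) + 1) * Real.pi),
        Real.cos_sub, Real.cos_add]
      ring
  have hz : ∀ k : ℕ, ∫ η : I, Real.exp (-eigenvalue k * t) *
      (2 * Real.cos (((k : ℝ) + 1) * Real.pi * ξ) *
        Real.cos (((k : ℝ) + 1) * Real.pi * (η : ℝ))) = 0 := by
    intro k
    have := integral_cos_int_mul_pi ((k : ℤ) + 1) (by omega)
    push_cast at this
    rw [integral_const_mul, integral_const_mul, this]
    simp
  simp only [hz] at key
  have h0 := key.unique hasSum_zero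
  have hc := continuous_theta ht
  rw [integral_sub (integrable_of_continuous (by fun_prop)) (integrable_const _)] at h0
  simp only [integral_const, probReal_univ, smul_eq_mul, mul_one] at h0
  linarith

lemma heat_apply {t : ℝ} (ht : 0 < t) (x : CSpace) (ξ : I) :
    heat t x ξ = ∫ η : I, (theta t (ξ - η) - theta t (ξ + η)) / 2 * x η := by
  have h1 := ContinuousMap.hasSum_apply (hasSum_sineSeries (summable_heat ht x)) ξ
  have h2 : HasSum (fun k : ℕ => ∫ η : I, Real.exp (-eigenvalue k * t) *
      (eigenfunction k ξ * eigenfunction k η) * x η)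
      (∫ η : I, (theta t (ξ - η) - theta t (ξ + η)) / 2 * x η) := by
    refine hasSum_integral_of_dominated_convergence
      (fun k _ => Real.exp (-eigenvalue k * t) * 2 * ‖x‖)
      (fun k => (by fun_prop : Continuous _).aestronglyMeasurable) (fun k => .of_forall fun η => ?_)
      (.of_forall fun _ => ((summable_exp_neg_eigenvalue ht).mul_right 2).mul_right _)
      (integrable_const _) (.of_forall fun η => (hasSum_dirichletKernel ht ξ η).mul_right _)
    rw [norm_mul, norm_mul, norm_mul]
    simp only [Real.norm_eq_abs, Real.abs_exp]
    have h1 := abs_eigenfunction_apply_le k ξ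
    have h2 := abs_eigenfunction_apply_le k η
    have h3 : |x η| ≤ ‖x‖ := x.norm_coe_le_norm η
    have h4 : Real.sqrt 2 * Real.sqrt 2 = 2 := Real.mul_self_sqrt (by norm_num)
    have h5 : |eigenfunction k ξ| * |eigenfunction k η| ≤ 2 := by
      rw [← h4]; gcongr
    gcongr
  refine h1.unique ?_
  convert h2 using 1
  ext k
  simp only [ContinuousMap.coe_smul, Pi.smul_apply, smul_eq_mul]
  rw [coeff_eq_integral, mul_assoc, mul_comm (∫ η : I, _) (eigenfunction k ξ), ← mul_assoc,
    ← integral_const_mul]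
  congr 1
  ext η
  ring

/-- The Dirichlet heat semigroup is a contraction for the supremum norm. -/
lemma norm_heat_le {t : ℝ} (ht : 0 < t) (x : CSpace) : ‖heat t x‖ ≤ ‖x‖ := by
  rw [ContinuousMap.norm_le _ (norm_nonneg x)]
  intro ξ
  have hc := continuous_theta ht
  have hi : Integrable fun η : I => (theta t (ξ - η) + theta t (ξ + η)) / 2 * ‖x‖ :=
    integrable_of_continuous (by fun_prop)
  rw [heat_apply ht]
  refine (norm_integral_le_of_norm_le hi (.of_forall fun η => ?_)).trans ?_
  · rw [norm_mul]
    refine mul_le_mul ?_ (x.norm_coe_le_norm η) (norm_nonneg _) ?_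
    -- For nonnegative theta values |a − b| ≤ a + b: Dirichlet is dominated by Neumann.
    · rw [Real.norm_eq_abs, abs_le]
      constructor <;> linarith [theta_nonneg ht ((ξ : ℝ) - η), theta_nonneg ht ((ξ : ℝ) + η)]
    · linarith [theta_nonneg ht ((ξ : ℝ) - η), theta_nonneg ht ((ξ : ℝ) + η)]
  · rw [integral_mul_const, integral_neumannKernel ht, one_mul]

/-! ### The integrated semigroup. -/

/-- The operator `A⁻¹ (I - S(t)) = ∫₀ᵗ S(s) ds` on continuous functions. -/
def integratedHeat (t : ℝ) (x : CSpace) : CSpace :=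
  sineSeries fun k => (eigenvalue k)⁻¹ * (coeff k x - Real.exp (-eigenvalue k * t) * coeff k x)

lemma summable_integratedHeat {t : ℝ} (ht : 0 < t) (x : CSpace) :
    Summable fun k => |(eigenvalue k)⁻¹ *
      (coeff k x - Real.exp (-eigenvalue k * t) * coeff k x)| := by
  refine (summable_inv_eigenvalue.mul_right ‖x‖).of_nonneg_of_le
    (fun _ => abs_nonneg _) fun k => ?_
  rw [abs_mul, abs_of_pos (inv_pos.2 (eigenvalue_pos k))]
  refine mul_le_mul_of_nonneg_left ?_ (inv_pos.2 (eigenvalue_pos k)).le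
  have h1 : Real.exp (-eigenvalue k * t) ≤ 1 :=
    Real.exp_le_one_iff.2 (by nlinarith [eigenvalue_pos k])
  have h2 := Real.exp_pos (-eigenvalue k * t)
  rw [← one_sub_mul, abs_mul, abs_of_nonneg (by linarith)]
  exact (mul_le_of_le_one_left (abs_nonneg _) (by linarith)).trans (abs_coeff_le k x)

lemma embed_integratedHeat {t : ℝ} (ht : 0 < t) (x : CSpace) :
    embed (integratedHeat t x) = invA (embed x - semigroup t (embed x)) := by
  rw [← embed_heat ht, ← map_sub, invA]
  refine (hasSum_embed_sineSeries (summable_integratedHeat ht x)).tsum_eq.symm.trans ?_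
  congr 1
  ext1 k
  change _ = ((eigenvalue k)⁻¹ * coeff k (x - heat t x)) • _
  rw [coeff_sub, heat, coeff_sineSeries (summable_heat ht x)]

lemma integratedHeat_sub {t : ℝ} (ht : 0 < t) (x y : CSpace) :
    integratedHeat t (x - y) = integratedHeat t x - integratedHeat t y := by
  have h := (hasSum_sineSeries (summable_integratedHeat ht x)).sub
    (hasSum_sineSeries (summable_integratedHeat ht y))
  refine Eq.trans ?_ h.tsum_eq
  rw [integratedHeat, sineSeries]
  congr 1
  ext1 k
  rw [← sub_smul, coeff_sub]
  congr 1
  ring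

/-- A⁻¹(I − S(t))x is the integral of S(s)x over (0, t], and each S(s) is a contraction. Sum and
integral are exchanged at a fixed point through the integrals of the norms, which decay like λₖ⁻¹; a
bound uniform in s would leave only the bare coefficients, which need not be summable. -/
lemma norm_integratedHeat_le {t : ℝ} (ht : 0 < t) (x : CSpace) :
    ‖integratedHeat t x‖ ≤ t * ‖x‖ := by
  rw [ContinuousMap.norm_le _ (by positivity)]
  intro ξ
  have h1 := ContinuousMap.hasSum_apply (hasSum_sineSeries (summable_integratedHeat ht x)) ξ
  have hI : ∀ k, ∫ s in Ioc 0 t, Real.exp (-eigenvalue k * s) =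
      (eigenvalue k)⁻¹ * (1 - Real.exp (-eigenvalue k * t)) := by
    intro k
    rw [← intervalIntegral.integral_of_le ht.le,
      intervalIntegral.integral_comp_mul_left (fun s => Real.exp s)
        (neg_ne_zero.2 (eigenvalue_pos k).ne')]
    simp
    ring
  have hint : ∀ k (c : ℝ), IntegrableOn (fun s => Real.exp (-eigenvalue k * s) * c) (Ioc 0 t) := by
    intro k c
    exact (by fun_prop : Continuous fun s => Real.exp (-eigenvalue k * s) * c).integrableOn_Ioc
  have h2 : HasSum (fun k : ℕ => ∫ s in Ioc 0 t, Real.exp (-eigenvalue k * s) *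
      (coeff k x * eigenfunction k ξ))
      (∫ s in Ioc 0 t, ∑' k : ℕ, Real.exp (-eigenvalue k * s) *
        (coeff k x * eigenfunction k ξ)) := by
    refine hasSum_integral_of_summable_integral_norm (fun k => hint k _) ?_
    refine (summable_inv_eigenvalue.mul_right (‖x‖ * Real.sqrt 2)).of_nonneg_of_le
      (fun k => integral_nonneg fun _ => norm_nonneg _) fun k => ?_
    simp only [norm_mul, Real.norm_eq_abs, Real.abs_exp]
    rw [integral_mul_const, hI]
    have e1 := abs_coeff_le k x
    have e2 := abs_eigenfunction_apply_le k ξ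
    have e3 := Real.exp_pos (-eigenvalue k * t)
    have e4 := inv_pos.2 (eigenvalue_pos k)
    gcongr
    exact mul_le_of_le_one_right e4.le (by linarith)
  have h3 : integratedHeat t x ξ = ∫ s in Ioc 0 t, ∑' k : ℕ, Real.exp (-eigenvalue k * s) *
        (coeff k x * eigenfunction k ξ) := by
    refine h1.unique ?_
    convert h2 using 1
    ext k
    rw [integral_mul_const, hI]
    simp only [ContinuousMap.coe_smul, Pi.smul_apply, smul_eq_mul]
    ring
  have h4 : ∀ s ∈ Ioc 0 t, ‖∑' k : ℕ, Real.exp (-eigenvalue k * s) *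
        (coeff k x * eigenfunction k ξ)‖ ≤ ‖x‖ := by
    intro s hs
    have := ContinuousMap.hasSum_apply (hasSum_sineSeries (summable_heat hs.1 x)) ξ
    simp only [ContinuousMap.coe_smul, Pi.smul_apply, smul_eq_mul, mul_assoc] at this
    rw [this.tsum_eq]
    exact ((heat s x).norm_coe_le_norm ξ).trans (norm_heat_le hs.1 x)
  rw [h3]
  refine (norm_setIntegral_le_of_norm_le_const (by simp) h4).trans ?_
  simp [Measure.real, ht.le, mul_comm]

/-! ### The flow of a one-sided Lipschitz vector field. -/

/-- Grönwall: w(s)e^{-cs} is nonincreasing. Neither `w` nor `c` needs a sign. -/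
lemma le_mul_exp_of_hasDerivWithinAt {w w' : ℝ → ℝ} {c T : ℝ}
    (hw : ∀ s ∈ Icc 0 T, HasDerivWithinAt w (w' s) (Icc 0 T) s)
    (hle : ∀ s ∈ Icc 0 T, w' s ≤ c * w s) {s : ℝ} (hs : s ∈ Icc 0 T) :
    w s ≤ w 0 * Real.exp (c * s) := by
  have hd : ∀ r ∈ Icc 0 T, HasDerivWithinAt (fun r => w r * Real.exp (-(c * r)))
      (w' r * Real.exp (-(c * r)) + w r * (Real.exp (-(c * r)) * -c)) (Icc 0 T) r := by
    intro r hr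
    have he : HasDerivAt (fun r : ℝ => Real.exp (-(c * r))) (Real.exp (-(c * r)) * -c) r := by
      have h := ((hasDerivAt_id r).const_mul c).neg.exp
      simpa using! h
    exact (hw r hr).mul he.hasDerivWithinAt
  have hanti : AntitoneOn (fun r => w r * Real.exp (-(c * r))) (Icc 0 T) := by
    refine antitoneOn_of_hasDerivWithinAt_nonpos (convex_Icc 0 T)
      (fun r hr => (hd r hr).continuousWithinAt)
      (fun r hr => (hd r (interior_subset hr)).mono interior_subset) fun r hr => ?_
    have h1 := hle r (interior_subset hr)
    have h2 := Real.exp_pos (-(c * r))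
    nlinarith
  have h := hanti (left_mem_Icc.2 (hs.1.trans hs.2)) hs hs.1
  simp only [mul_zero, neg_zero, Real.exp_zero, mul_one] at h
  calc w s = w s * Real.exp (-(c * s)) * Real.exp (c * s) := by
        rw [mul_assoc, ← Real.exp_add]; simp
    _ ≤ _ := mul_le_mul_of_nonneg_right h (Real.exp_pos _).le

lemma abs_sub_le_of_oneSidedLipschitz {F : ℝ → ℝ} {L T : ℝ}
    (hF : ∀ z₁ z₂ : ℝ, (z₂ - z₁) * (F z₂ - F z₁) ≤ L * (z₂ - z₁) ^ 2) {u v : ℝ → ℝ}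
    (hu : ∀ s ∈ Icc 0 T, HasDerivWithinAt u (F (u s)) (Icc 0 T) s)
    (hv : ∀ s ∈ Icc 0 T, HasDerivWithinAt v (F (v s)) (Icc 0 T) s) {s : ℝ} (hs : s ∈ Icc 0 T) :
    |u s - v s| ≤ Real.exp (L * s) * |u 0 - v 0| := by
  have h := le_mul_exp_of_hasDerivWithinAt (w := fun r => (u r - v r) ^ 2) (c := 2 * L)
    (fun r hr => ((hu r hr).sub (hv r hr)).pow 2)
    (fun r _ => by
      have := hF (v r) (u r)
      simp only [Nat.cast_ofNat, Nat.add_one_sub_one, pow_one, Pi.sub_apply]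
      linarith) hs
  refine abs_le_of_sq_le_sq (h.trans_eq ?_) (by positivity)
  rw [mul_pow, sq_abs, ← Real.exp_nat_mul, mul_comm]
  congr 2
  push_cast
  ring

/-- Grönwall for u² + a², using 2a|u| ≤ u² + a². Only a growth bound is assumed, so the estimate
serves both the truncated field and `f` itself. -/
lemma sq_le_of_growth {F : ℝ → ℝ} {L a T : ℝ} (hL : 0 ≤ L)
    (hF : ∀ z : ℝ, z * F z ≤ L * z ^ 2 + a * |z|) {u : ℝ → ℝ}
    (hu : ∀ s ∈ Icc 0 T, HasDerivWithinAt u (F (u s)) (Icc 0 T) s) {s : ℝ} (hs : s ∈ Icc 0 T) :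
    u s ^ 2 ≤ (u 0 ^ 2 + a ^ 2) * Real.exp ((2 * L + 1) * s) := by
  have h := le_mul_exp_of_hasDerivWithinAt (w := fun r => u r ^ 2 + a ^ 2) (c := 2 * L + 1)
    (fun r hr => ((hu r hr).pow 2).add_const (a ^ 2))
    (fun r _ => by
      have := hF (u r)
      have h2 := sq_abs (u r)
      simp only [Nat.cast_ofNat, Nat.add_one_sub_one, pow_one]
      nlinarith [sq_nonneg (|u r| - a), mul_nonneg hL (sq_nonneg a)]) hs
  nlinarith [sq_nonneg a]

lemma mul_apply_le_of_oneSidedLipschitz {f : ℝ → ℝ} {L : ℝ}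
    (hf : ∀ z₁ z₂ : ℝ, (z₂ - z₁) * (f z₂ - f z₁) ≤ L * (z₂ - z₁) ^ 2) (z : ℝ) :
    z * f z ≤ L * z ^ 2 + |f 0| * |z| := by
  have h := hf 0 z
  simp only [sub_zero] at h
  have h2 := (le_abs_self (z * f 0)).trans_eq (abs_mul _ _)
  linarith

/-- The field is frozen outside [−R, R], which makes it bounded and globally Lipschitz. The a priori
bound keeps the solution inside [−R, R], where truncation changes nothing. -/
lemma exists_local_trajectory {f : ℝ → ℝ} (hf : IsOneSidedLipschitz f) (z : ℝ) {T : ℝ}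
    (hT : 0 ≤ T) :
    ∃ u : ℝ → ℝ, u 0 = z ∧ ∀ s ∈ Icc 0 T, HasDerivWithinAt u (f (u s)) (Icc 0 T) s := by
  obtain ⟨L, hL, h1, q, h2⟩ := hf
  set a : ℝ := |f 0|
  have ha : 0 ≤ a := abs_nonneg _
  -- The a priori bound of `sq_le_of_growth` at time `T`; the added 1 makes `R` strictly positive,
  -- which permits division by `R` below.
  set R : ℝ := Real.sqrt ((z ^ 2 + a ^ 2) * Real.exp ((2 * L + 1) * T)) + 1 with hR
  have hRpos : 0 < R := by positivity
  have hR0 : 0 ≤ R := hRpos.le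
  set c : ℝ → ℝ := fun y => max (-R) (min R y) with hc
  have hc_abs : ∀ y, |c y| ≤ R := fun y =>
    abs_le.2 ⟨le_max_left _ _, max_le (by linarith) (min_le_left _ _)⟩
  have hc_lip : ∀ x y, |c x - c y| ≤ |x - y| := fun x y => by
    refine (abs_max_sub_max_le_max _ _ _ _).trans ?_
    rw [sub_self, abs_zero, max_eq_right (abs_nonneg _)]
    refine (abs_min_sub_min_le_max _ _ _ _).trans ?_
    rw [sub_self, abs_zero, max_eq_right (abs_nonneg _)]
  have hc_eq : ∀ y, |y| ≤ R → c y = y := fun y hy => by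
    rw [hc]
    simp only
    rw [min_eq_right (abs_le.1 hy).2, max_eq_right (abs_le.1 hy).1]
  set K : ℝ := L * (1 + R ^ (2 * q) + R ^ (2 * q))
  have hK : 0 ≤ K := by positivity
  have hlip : ∀ x y, |f (c x) - f (c y)| ≤ K * |x - y| := fun x y => by
    refine (h2 _ _).trans ?_
    have e1 := pow_le_pow_left₀ (abs_nonneg _) (hc_abs x) (2 * q)
    have e2 := pow_le_pow_left₀ (abs_nonneg _) (hc_abs y) (2 * q)
    have e3 := hc_lip x y
    have e4 : 1 + |c y| ^ (2 * q) + |c x| ^ (2 * q) ≤ 1 + R ^ (2 * q) + R ^ (2 * q) := by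
      linarith
    exact mul_le_mul (mul_le_mul_of_nonneg_left e4 hL) e3 (abs_nonneg _) hK
  set M : ℝ := a + K * R
  have hM : 0 ≤ M := by positivity
  have hbdd : ∀ y, |f (c y)| ≤ M := fun y => by
    have e := hlip (c y) 0
    rw [hc_eq 0 (by simpa using hR0), hc_eq (c y) (hc_abs y), sub_zero] at e
    have e2 := hc_abs y
    calc |f (c y)| = |f 0 + (f (c y) - f 0)| := by ring_nf
      _ ≤ |f 0| + |f (c y) - f 0| := abs_add_le _ _
      _ ≤ a + K * R := by gcongr; exact e.trans (by gcongr)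
  have hgrow : ∀ y, y * f (c y) ≤ L * y ^ 2 + a * |y| := fun y => by
    have hm := mul_apply_le_of_oneSidedLipschitz h1
    -- Outside [−R, R] the truncated field is the constant f(±R), and the one-sided condition
    -- between 0 and ±R bounds it in the outward direction.
    rcases le_or_gt |y| R with hy | hy
    · rw [hc_eq y hy]; exact hm y
    · have hf0 := abs_le.1 (le_refl |f 0|)
      rcases lt_abs.1 hy with hy | hy
      · have hcy : c y = R := by
          simp only [hc]
          rw [min_eq_left hy.le, max_eq_right (by linarith)]
        have h3 := h1 0 R
        have h4 : f R ≤ L * R + f 0 := by nlinarith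
        rw [hcy, abs_of_pos (hRpos.trans hy)]
        nlinarith [mul_nonneg hL (sub_pos.2 hy).le]
      · have hcy : c y = -R := by
          simp only [hc]
          rw [min_eq_right (by linarith), max_eq_left (by linarith)]
        have h3 := h1 0 (-R)
        have h4 : f 0 - L * R ≤ f (-R) := by nlinarith
        rw [hcy, abs_of_neg (by linarith)]
        nlinarith [mul_nonneg hL (sub_pos.2 hy).le]
  -- The field is bounded by `M`, so a ball of radius `M * T` lets Picard–Lindelöf reach the whole
  -- interval at once.
  obtain ⟨u, hu0, hu⟩ := IsPicardLindelof.exists_eq_forall_mem_Icc_hasDerivWithinAt₀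
    (f := fun _ y => f (c y)) (tmin := 0) (tmax := T) (t₀ := ⟨0, left_mem_Icc.2 hT⟩) (x₀ := z)
    (a := ⟨M * T, by positivity⟩) (L := ⟨M, hM⟩) (K := ⟨K, hK⟩)
    { lipschitzOnWith := fun t _ => LipschitzOnWith.of_dist_le_mul fun x _ y _ => hlip x y
      continuousOn := fun x _ => continuousOn_const
      norm_le := fun t _ x _ => hbdd x
      mul_max_le := by
        change M * max (T - 0) (0 - 0) ≤ M * T - 0
        simp [hT] }
  refine ⟨u, hu0, fun s hs => ?_⟩
  have hus : |u s| ≤ R := by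
    have e1 := sq_le_of_growth hL hgrow hu hs
    rw [show u 0 = z from hu0] at e1
    refine (Real.abs_le_sqrt (e1.trans ?_)).trans (le_add_of_nonneg_right zero_le_one)
    have := hs.2
    gcongr
  have h3 := hu s hs
  simp only [hc_eq _ hus] at h3
  exact h3


lemma exists_isTrajectory {f : ℝ → ℝ} (hf : IsOneSidedLipschitz f) (z : ℝ) :
    ∃ u : ℝ → ℝ, IsTrajectory f z u := by
  choose u hu0 hu using fun n : ℕ =>
    exists_local_trajectory hf z (T := (n : ℝ) + 1) (by positivity)
  obtain ⟨L, hL, h1, -⟩ := hf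
  have huniq : ∀ m n : ℕ, m ≤ n → ∀ s ∈ Icc (0 : ℝ) (m + 1), u m s = u n s := by
    intro m n hmn s hs
    have hsub : Icc (0 : ℝ) (m + 1) ⊆ Icc (0 : ℝ) (n + 1) :=
      Icc_subset_Icc_right (by gcongr)
    have h := abs_sub_le_of_oneSidedLipschitz h1 (hu m)
      (fun r hr => (hu n r (hsub hr)).mono hsub) hs
    rw [hu0, hu0, sub_self, abs_zero, mul_zero] at h
    exact sub_eq_zero.1 (abs_nonpos_iff.1 h)
  refine ⟨fun s => u ⌊s⌋₊ s, by simp [hu0], fun s hs => ?_⟩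
  -- The index ⌊r⌋ jumps when `s` is an integer. Near `s` the glued function is therefore compared
  -- with the single solution of index ⌊s⌋ + 1, which is defined beyond `s`.
  have heq : ∀ r ∈ Ico (0 : ℝ) (⌊s⌋₊ + 2), u ⌊r⌋₊ r = u (⌊s⌋₊ + 1) r := by
    intro r hr
    refine huniq _ _ ?_ r ⟨hr.1, (Nat.lt_floor_add_one r).le⟩
    refine Nat.lt_succ_iff.1 ((Nat.floor_lt hr.1).2 ?_)
    push_cast
    linarith [hr.2]
  have hs1 : s ∈ Ico (0 : ℝ) (⌊s⌋₊ + 2) := ⟨hs, by linarith [Nat.lt_floor_add_one s]⟩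
  have hmem : Ico (0 : ℝ) (⌊s⌋₊ + 2) ∈ nhdsWithin s (Ici 0) := by
    rw [← Ici_inter_Iio]
    exact inter_mem_nhdsWithin _ (Iio_mem_nhds hs1.2)
  have h2 := hu (⌊s⌋₊ + 1) s ⟨hs, by push_cast; linarith [hs1.2]⟩
  have h3 : HasDerivWithinAt (u (⌊s⌋₊ + 1)) (f (u (⌊s⌋₊ + 1) s)) (Ici 0) s := by
    refine h2.mono_of_mem_nhdsWithin (Filter.mem_of_superset hmem fun r hr => ⟨hr.1, ?_⟩)
    push_cast
    linarith [hr.2]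
  simp only [heq s hs1]
  exact h3.congr_of_eventuallyEq (Filter.eventually_of_mem hmem heq) (heq s hs1)

lemma flow_isTrajectory {f : ℝ → ℝ} (hf : IsOneSidedLipschitz f) (z : ℝ) :
    IsTrajectory f z fun s => flow f s z := by
  have h := exists_isTrajectory hf z
  have h2 : (fun s => flow f s z) = h.choose := by
    ext s
    rw [flow, dif_pos h]
  rw [h2]
  exact h.choose_spec

lemma flow_zero {f : ℝ → ℝ} (hf : IsOneSidedLipschitz f) (z : ℝ) : flow f 0 z = z :=
  (flow_isTrajectory hf z).1

lemma hasDerivWithinAt_flow {f : ℝ → ℝ} (hf : IsOneSidedLipschitz f) (z T : ℝ) :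
    ∀ s ∈ Icc 0 T, HasDerivWithinAt (fun r => flow f r z) (f (flow f s z)) (Icc 0 T) s :=
  fun s hs => ((flow_isTrajectory hf z).2 s hs.1).mono Icc_subset_Ici_self

/-- The growth of a one-sided Lipschitz function is at most polynomial. -/
lemma exists_polynomial_growth {f : ℝ → ℝ} (hf : IsOneSidedLipschitz f) :
    ∃ (K : ℝ) (m : ℕ), 0 ≤ K ∧ 1 ≤ m ∧ ∀ w, |f w| ≤ K * (1 + |w|) ^ m := by
  obtain ⟨L, hL, -, q, h2⟩ := hf
  refine ⟨|f 0| + 3 * L, 2 * q + 1, by positivity, by omega, fun w => ?_⟩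
  have h := h2 0 w
  have hw := abs_nonneg w
  have h1 : (1 : ℝ) ≤ (1 + |w|) ^ (2 * q) := one_le_pow₀ (by linarith)
  have h3 : |w| ^ (2 * q) ≤ (1 + |w|) ^ (2 * q) := by gcongr; linarith
  have h4 : |(0 : ℝ)| ^ (2 * q) ≤ 1 := by simpa using pow_le_one₀ le_rfl zero_le_one
  have h5 : |f w| ≤ |f 0| + |f w - f 0| := by
    calc |f w| = |f 0 + (f w - f 0)| := by ring_nf
      _ ≤ _ := abs_add_le _ _
  rw [sub_zero] at h
  have h6 : |f w - f 0| ≤ L * (3 * (1 + |w|) ^ (2 * q)) * (1 + |w|) := by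
    refine h.trans ?_
    gcongr
    · linarith
    · linarith
  have h7 : |f 0| ≤ |f 0| * (1 + |w|) ^ (2 * q + 1) :=
    le_mul_of_one_le_right (abs_nonneg _) (one_le_pow₀ (by linarith))
  rw [pow_succ] at h7 ⊢
  nlinarith

/-- Stability of the flow of a one-sided Lipschitz vector field, and its distance to the
identity. -/
lemma exists_flow_bounds {f : ℝ → ℝ} (hf : IsOneSidedLipschitz f) (T : ℝ) :
    ∃ (L K : ℝ) (m : ℕ), 0 ≤ L ∧ 0 ≤ K ∧ 1 ≤ m ∧ ∀ s ∈ Icc 0 T,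
      (∀ y z, |flow f s y - flow f s z| ≤ Real.exp (L * s) * |y - z|) ∧
      ∀ z, |flow f s z - z| ≤ s * (K * (1 + |z|) ^ m) := by
  obtain ⟨K, m, hK, hm, hg⟩ := exists_polynomial_growth hf
  have hf' := hf
  obtain ⟨L, hL, h1, -⟩ := hf'
  set a : ℝ := |f 0|
  set E : ℝ := Real.exp ((2 * L + 1) * T)
  -- Up to time `T` the trajectory stays below (|z| + a)E, and 1 + (|z| + a)E ≤ (1 + a)E(1 + |z|);
  -- the growth bound of `f` along it gives this constant.
  refine ⟨L, K * ((1 + a) * E) ^ m, m, hL, by positivity, hm, fun s hs => ⟨fun y z => ?_,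
    fun z => ?_⟩⟩
  · have h := abs_sub_le_of_oneSidedLipschitz h1 (hasDerivWithinAt_flow hf y T)
      (hasDerivWithinAt_flow hf z T) hs
    simpa only [flow_zero hf] using h
  · have ha : 0 ≤ a := abs_nonneg _
    have hE : 1 ≤ E := Real.one_le_exp (mul_nonneg (by linarith) (hs.1.trans hs.2))
    have hbd : ∀ r ∈ Icc 0 s, |f (flow f r z)| ≤ K * ((1 + a) * E) ^ m * (1 + |z|) ^ m := by
      intro r hr
      have e1 := sq_le_of_growth hL (mul_apply_le_of_oneSidedLipschitz h1)
        (hasDerivWithinAt_flow hf z s) hr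
      simp only [flow_zero hf] at e1
      have e2 : Real.exp ((2 * L + 1) * r) ≤ E :=
        Real.exp_le_exp.2 (mul_le_mul_of_nonneg_left (hr.2.trans hs.2) (by linarith))
      have hz := abs_nonneg z
      have e3 : |flow f r z| ≤ (|z| + a) * E := by
        refine abs_le_of_sq_le_sq ?_ (by positivity)
        calc flow f r z ^ 2 ≤ (z ^ 2 + a ^ 2) * E := e1.trans (by gcongr)
          _ = (|z| ^ 2 + a ^ 2) * E := by rw [sq_abs z]
          _ ≤ (|z| + a) ^ 2 * E ^ 2 := by
            have : |z| ^ 2 + a ^ 2 ≤ (|z| + a) ^ 2 := by nlinarith [mul_nonneg hz ha]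
            have : E ≤ E ^ 2 := by nlinarith
            gcongr
          _ = _ := by ring
      refine (hg _).trans ?_
      rw [mul_assoc, ← mul_pow]
      gcongr
      nlinarith [mul_nonneg ha hz, mul_nonneg (mul_nonneg ha hz) (zero_le_one.trans hE)]
    have h := Convex.norm_image_sub_le_of_norm_hasDerivWithin_le (hasDerivWithinAt_flow hf z s)
      hbd (convex_Icc 0 s) (left_mem_Icc.2 hs.1) (right_mem_Icc.2 hs.1)
    rw [flow_zero hf, Real.norm_eq_abs, Real.norm_eq_abs, sub_zero, abs_of_nonneg hs.1] at h
    linarith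

lemma continuous_flow {f : ℝ → ℝ} (hf : IsOneSidedLipschitz f) {s : ℝ} (hs : 0 ≤ s) :
    Continuous (flow f s) := by
  obtain ⟨L, K, m, -, -, -, h⟩ := exists_flow_bounds hf s
  exact (LipschitzWith.of_dist_le_mul (K := ⟨Real.exp (L * s), (Real.exp_pos _).le⟩)
    fun y z => (h s ⟨hs, le_rfl⟩).1 y z).continuous

/-! ### The discrete convolution and its deterministic weights. -/

/-- The discrete convolution `y (n+1) = ρ (y n + b (n+1) - b n)`, `y 0 = 0`. -/
def discreteConv (ρ : ℝ) (b : ℕ → ℝ) : ℕ → ℝ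
  | 0 => 0
  | n + 1 => ρ * (discreteConv ρ b n + (b (n + 1) - b n))

/-- Summation by parts. Increments over single steps are correlated, whereas each b(n) − b(n − i)
has a known L² norm and the weights are nonnegative for 0 ≤ ρ ≤ 1, so a plain triangle inequality
loses only a constant. -/
lemma discreteConv_eq_sum (ρ : ℝ) (b : ℕ → ℝ) (n : ℕ) :
    discreteConv ρ b n = ρ ^ n * (b n - b 0) +
      ∑ i ∈ Finset.range n, (ρ ^ i - ρ ^ (i + 1)) * (b n - b (n - i)) := by
  induction n with
  | zero => simp [discreteConv]
  | succ n ih =>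
    have h1 : ∑ i ∈ Finset.range n, (ρ ^ (i + 1) - ρ ^ (i + 2)) = ρ - ρ ^ (n + 1) := by
      simpa using Finset.sum_range_sub' (fun i => ρ ^ (i + 1)) n
    have h2 : ∑ i ∈ Finset.range n, (ρ ^ (i + 1) - ρ ^ (i + 2)) * (b (n + 1) - b (n - i)) =
        (ρ - ρ ^ (n + 1)) * (b (n + 1) - b n) +
          ρ * ∑ i ∈ Finset.range n, (ρ ^ i - ρ ^ (i + 1)) * (b n - b (n - i)) := by
      rw [← h1, Finset.sum_mul, Finset.mul_sum, ← Finset.sum_add_distrib]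
      refine Finset.sum_congr rfl fun i _ => ?_
      ring
    rw [discreteConv, ih, Finset.sum_range_succ']
    simp only [Nat.add_sub_add_right, Nat.sub_zero, sub_self, mul_zero, add_zero]
    rw [h2]
    ring

/-- Linearity in finitely many values is all that Gaussianity, vanishing mean and measurability
require. -/
lemma exists_discreteConv_eq_linear (ρ : ℝ) (n : ℕ) :
    ∃ c : ℕ → ℝ, ∀ b : ℕ → ℝ, discreteConv ρ b n = ∑ i ∈ Finset.range (n + 1), c i * b i := by
  induction n with
  | zero => exact ⟨0, by simp [discreteConv]⟩
  | succ n ih =>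
    obtain ⟨c, hc⟩ := ih
    refine ⟨fun i => ρ * ((if i = n + 1 then 0 else c i) + (if i = n + 1 then 1 else 0) -
      (if i = n then 1 else 0)), fun b => ?_⟩
    have hc' : ∑ i ∈ Finset.range (n + 1), (if i = n + 1 then 0 else c i) * b i =
        ∑ i ∈ Finset.range (n + 1), c i * b i :=
      Finset.sum_congr rfl fun i hi => by rw [if_neg (Finset.mem_range.1 hi).ne]
    rw [discreteConv, hc b]
    simp only [mul_assoc, ← Finset.mul_sum, add_mul, sub_mul, Finset.sum_add_distrib,
      Finset.sum_sub_distrib]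
    rw [Finset.sum_range_succ (fun i => (if i = n + 1 then 0 else c i) * b i), hc']
    simp only [ite_mul, one_mul, zero_mul, Finset.sum_ite_eq', Finset.mem_range,
      Finset.sum_range_succ _ (n + 1), lt_add_iff_pos_right, if_true]
    simp
    ring_nf
    simp

lemma rpow_le_two_mul_exp {u H : ℝ} (hu : 0 ≤ u) (hH : 0 ≤ H) (hH1 : H ≤ 1) :
    u ^ H ≤ 2 * Real.exp (u / 2) := by
  have h1 : u ^ H ≤ 1 + u := by
    rcases le_total u 1 with h | h
    · exact (Real.rpow_le_one hu h hH).trans (by linarith)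
    · exact (Real.rpow_le_rpow_of_exponent_le h hH1).trans (by rw [Real.rpow_one]; linarith)
  linarith [Real.add_one_le_exp (u / 2)]

/-- The bound on the coefficients which yields the regularity of the stochastic convolution. -/
lemma discreteConv_weights_le {l h H : ℝ} (hl : 0 < l) (hh : 0 ≤ h) (hH : 0 ≤ H) (hH1 : H ≤ 1)
    (n : ℕ) :
    Real.exp (-l * h) ^ n * ((n : ℝ) * h) ^ H + ∑ i ∈ Finset.range n,
      (Real.exp (-l * h) ^ i - Real.exp (-l * h) ^ (i + 1)) * ((i : ℝ) * h) ^ H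
      ≤ 6 * l ^ (-H) := by
  -- The decay is split into two halves: one factor τ^i absorbs (ih)^H, the other leaves the
  -- telescoping differences τ^i − τ^(i+1). The bound is 2 from the boundary term plus 4 from the
  -- sum.
  set τ : ℝ := Real.exp (-(l * h) / 2) with hτ
  have hτ0 : 0 < τ := Real.exp_pos _
  have hτ1 : τ ≤ 1 := Real.exp_le_one_iff.2 (by nlinarith [mul_nonneg hl.le hh])
  have hρ : Real.exp (-l * h) = τ ^ 2 := by
    rw [hτ, ← Real.exp_nat_mul]; congr 1; push_cast; ring
  have key : ∀ i : ℕ, τ ^ i * ((i : ℝ) * h) ^ H ≤ 2 * l ^ (-H) := by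
    intro i
    have h1 := rpow_le_two_mul_exp (u := l * (i * h)) (by positivity) hH hH1
    rw [Real.mul_rpow hl.le (by positivity)] at h1
    have h2 : τ ^ i = (Real.exp (l * (i * h) / 2))⁻¹ := by
      rw [hτ, ← Real.exp_nat_mul, ← Real.exp_neg]; congr 1; ring
    have h3 : 0 < l ^ H := Real.rpow_pos_of_pos hl H
    rw [h2, Real.rpow_neg hl.le, ← div_eq_mul_inv, inv_mul_eq_div, div_le_div_iff₀
      (Real.exp_pos _) h3]
    linarith
  have hl0 : 0 < l ^ (-H) := Real.rpow_pos_of_pos hl _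
  have h1 : (τ ^ 2) ^ n * ((n : ℝ) * h) ^ H ≤ 2 * l ^ (-H) := by
    have e : (τ ^ 2) ^ n = τ ^ n * τ ^ n := by rw [← pow_mul, ← pow_add]; congr 1; ring
    rw [e, mul_assoc]
    exact (mul_le_of_le_one_left (by positivity) (pow_le_one₀ hτ0.le hτ1)).trans (key n)
  have h2 : ∀ i ∈ Finset.range n, ((τ ^ 2) ^ i - (τ ^ 2) ^ (i + 1)) * ((i : ℝ) * h) ^ H ≤
      4 * l ^ (-H) * (τ ^ i - τ ^ (i + 1)) := by
    intro i _
    have e : (τ ^ 2) ^ i = τ ^ i * τ ^ i := by rw [← pow_mul, ← pow_add]; congr 1; ring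
    have e2 : ((τ ^ 2) ^ i - (τ ^ 2) ^ (i + 1)) * ((i : ℝ) * h) ^ H =
        (1 + τ) * ((τ ^ i - τ ^ (i + 1)) * (τ ^ i * ((i : ℝ) * h) ^ H)) := by
      rw [pow_succ (τ ^ 2), e]; ring
    have e3 : 0 ≤ τ ^ i - τ ^ (i + 1) := by
      rw [pow_succ]; nlinarith [pow_pos hτ0 i]
    rw [e2]
    calc (1 + τ) * ((τ ^ i - τ ^ (i + 1)) * (τ ^ i * ((i : ℝ) * h) ^ H))
        ≤ 2 * ((τ ^ i - τ ^ (i + 1)) * (2 * l ^ (-H))) := by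
          have := key i
          gcongr
          linarith
      _ = _ := by ring
  rw [hρ]
  refine (add_le_add h1 (Finset.sum_le_sum h2)).trans ?_
  rw [← Finset.mul_sum, Finset.sum_range_sub' (fun i => τ ^ i), pow_zero]
  nlinarith [pow_pos hτ0 n]

/-! ### Gaussian coefficients and their moments. -/

section Probability

variable {Ω : Type*} [MeasurableSpace Ω] {P : Measure Ω}

lemma eLpNorm_natCast_eq {E : Type*} [NormedAddCommGroup E] {f : Ω → E} {r : ℕ} (hr : 1 ≤ r)
    (hf : MemLp f r P) :
    eLpNorm f r P = ENNReal.ofReal ((∫ ω, ‖f ω‖ ^ r ∂P) ^ (1 / (r : ℝ))) := by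
  rw [hf.eLpNorm_eq_integral_rpow_norm (by exact_mod_cast (by omega : r ≠ 0))
    (ENNReal.natCast_ne_top r)]
  simp

lemma IsFBM.eLpNorm_increment {H : ℝ} (hH : 0 < H) {β : ℝ≥0 → Ω → ℝ} (hβ : IsFBM H β P)
    (t s : ℝ≥0) :
    eLpNorm (fun ω => β t ω - β s ω) 2 P = ENNReal.ofReal (|(t : ℝ) - s| ^ H) := by
  have hm : ∀ t, MemLp (β t) 2 P := fun t => (hβ.gaussian.hasGaussianLaw_eval t).memLp_two
  have hi : ∀ t s, Integrable (fun ω => β t ω * β s ω) P := fun t s => (hm t).integrable_mul (hm s)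
  have h1 : ∫ ω, ‖β t ω - β s ω‖ ^ 2 ∂P = |(t : ℝ) - s| ^ (2 * H) := by
    have e : ∀ ω, ‖β t ω - β s ω‖ ^ 2 = β t ω * β t ω - 2 * (β t ω * β s ω) + β s ω * β s ω := by
      intro ω
      rw [Real.norm_eq_abs, sq_abs]
      ring
    simp_rw [e]
    rw [integral_add (f := fun ω => β t ω * β t ω - 2 * (β t ω * β s ω))
      ((hi t t).sub ((hi t s).const_mul 2)) (hi s s),
      integral_sub (hi t t) ((hi t s).const_mul 2), integral_const_mul, hβ.covariance,
      hβ.covariance, hβ.covariance]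
    simp only [sub_self, abs_zero]
    rw [Real.zero_rpow (by positivity)]
    ring
  have h2 := eLpNorm_natCast_eq (r := 2) (by norm_num) ((hm t).sub (hm s))
  simp only [Nat.cast_ofNat, Pi.sub_apply, h1] at h2
  refine Eq.trans h2 ?_
  rw [← Real.rpow_mul (abs_nonneg _)]
  congr 2
  ring

lemma IsFBM.eLpNorm_discreteConv_le {H : ℝ} (hH : 0 < H) (hH1 : H ≤ 1) {β : ℝ≥0 → Ω → ℝ}
    (hβ : IsFBM H β P) {l : ℝ} (hl : 0 < l) (h : ℝ≥0) (n : ℕ) :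
    eLpNorm (fun ω => discreteConv (Real.exp (-l * h)) (fun i => β (i * h) ω) n) 2 P ≤
      ENNReal.ofReal (6 * l ^ (-H)) := by
  set ρ := Real.exp (-l * h) with hρ
  have hρ0 : 0 < ρ := Real.exp_pos _
  have hρ1 : ρ ≤ 1 := Real.exp_le_one_iff.2 (by nlinarith [mul_nonneg hl.le h.2])
  have hmeas : ∀ (c : ℝ) (s t : ℝ≥0),
      AEStronglyMeasurable (fun ω => c * (β s ω - β t ω)) P := fun c s t =>
    (((hβ.measurable s).sub (hβ.measurable t)).const_mul c).aestronglyMeasurable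
  have hnorm : ∀ (c : ℝ) (s t : ℝ≥0), 0 ≤ c → eLpNorm (fun ω => c * (β s ω - β t ω)) 2 P =
      ENNReal.ofReal (c * |(s : ℝ) - t| ^ H) := by
    intro c s t hc
    have := eLpNorm_const_smul c (fun ω => β s ω - β t ω) 2 P
    rw [hβ.eLpNorm_increment hH, Real.enorm_of_nonneg hc, ← ENNReal.ofReal_mul hc] at this
    exact this
  have hc : ∀ i : ℕ, 0 ≤ ρ ^ i - ρ ^ (i + 1) := fun i => by
    rw [pow_succ]; nlinarith [pow_pos hρ0 i]
  have e : (fun ω => discreteConv ρ (fun i => β (i * h) ω) n) =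
      (fun ω => ρ ^ n * (β (n * h) ω - β 0 ω)) + ∑ i ∈ Finset.range n,
        (fun ω => (ρ ^ i - ρ ^ (i + 1)) * (β (n * h) ω - β ((n - i : ℕ) * h) ω)) := by
    ext ω
    rw [discreteConv_eq_sum]
    simp
  rw [e]
  refine (eLpNorm_add_le (hmeas _ _ _) (Finset.aestronglyMeasurable_sum _ fun i _ => hmeas _ _ _)
    (by norm_num)).trans ?_
  refine (add_le_add le_rfl (eLpNorm_sum_le (fun i _ => hmeas _ _ _) (by norm_num))).trans ?_
  rw [hnorm _ _ _ (by positivity), Finset.sum_congr rfl fun i _ => hnorm _ _ _ (hc i),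
    ← ENNReal.ofReal_sum_of_nonneg fun i _ => mul_nonneg (hc i) (by positivity),
    ← ENNReal.ofReal_add (by positivity)
      (Finset.sum_nonneg fun i _ => mul_nonneg (hc i) (by positivity))]
  refine ENNReal.ofReal_le_ofReal (le_trans (le_of_eq ?_)
    (discreteConv_weights_le hl (NNReal.coe_nonneg h) hH.le hH1 n))
  congr 1
  · rw [NNReal.coe_mul, NNReal.coe_natCast, NNReal.coe_zero, sub_zero,
      abs_of_nonneg (by positivity), hρ]
  · refine Finset.sum_congr rfl fun i hi => ?_
    have hi' := (Finset.mem_range.1 hi).le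
    rw [NNReal.coe_mul, NNReal.coe_mul, NNReal.coe_natCast, NNReal.coe_natCast, Nat.cast_sub hi',
      ← sub_mul, sub_sub_cancel, abs_of_nonneg (by positivity), hρ]

lemma IsFBM.hasGaussianLaw_discreteConv {H : ℝ} {β : ℝ≥0 → Ω → ℝ} (hβ : IsFBM H β P) (ρ : ℝ)
    (h : ℝ≥0) (n : ℕ) :
    HasGaussianLaw (fun ω => discreteConv ρ (fun i => β (i * h) ω) n) P := by
  obtain ⟨c, hc⟩ := exists_discreteConv_eq_linear ρ n
  simp_rw [hc]
  exact ((hβ.gaussian.comp_right fun i : ℕ => (i : ℝ≥0) * h).smul c).hasGaussianLaw_fun_sum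

lemma IsFBM.integral_discreteConv {H : ℝ} {β : ℝ≥0 → Ω → ℝ} (hβ : IsFBM H β P) (ρ : ℝ)
    (h : ℝ≥0) (n : ℕ) :
    ∫ ω, discreteConv ρ (fun i => β (i * h) ω) n ∂P = 0 := by
  obtain ⟨c, hc⟩ := exists_discreteConv_eq_linear ρ n
  simp_rw [hc]
  rw [integral_finsetSum _ fun i _ => ((hβ.gaussian.hasGaussianLaw_eval _).integrable).const_mul _]
  simp [integral_const_mul, hβ.mean]

lemma hasSubgaussianMGF_of_gaussian {X : Ω → ℝ} (hX : HasGaussianLaw X P)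
    (h0 : ∫ ω, X ω ∂P = 0) {τ : ℝ} (hτ : 0 ≤ τ) (h2 : eLpNorm X 2 P ≤ ENNReal.ofReal τ) :
    HasSubgaussianMGF X (τ ^ 2).toNNReal P := by
  have := hX.isProbabilityMeasure
  have hmap := hX.map_eq_gaussianReal
  rw [h0] at hmap
  have hvar : Var[X; P] ≤ τ ^ 2 := by
    rw [variance_eq_integral hX.aemeasurable, h0]
    have e := eLpNorm_natCast_eq (r := 2) (by norm_num) hX.memLp_two
    rw [Nat.cast_ofNat] at e
    rw [e, ENNReal.ofReal_le_ofReal_iff hτ] at h2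
    have h3 : 0 ≤ ∫ ω, ‖X ω‖ ^ 2 ∂P := integral_nonneg fun _ => by positivity
    have h4 := pow_le_pow_left₀ (by positivity) h2 2
    rw [← Real.rpow_natCast, ← Real.rpow_mul h3] at h4
    simpa using h4
  refine ⟨fun t => ?_, fun t => ?_⟩
  · have h1 := integrable_exp_mul_gaussianReal (μ := 0) (v := Var[X; P].toNNReal) t
    rw [← hmap] at h1
    exact h1.comp_aemeasurable hX.aemeasurable
  · rw [mgf_gaussianReal hmap, zero_mul, zero_add]
    gcongr

lemma IsFBM.hasSubgaussianMGF_discreteConv {H : ℝ} (hH : 0 < H) (hH1 : H ≤ 1) {β : ℝ≥0 → Ω → ℝ}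
    (hβ : IsFBM H β P) {l : ℝ} (hl : 0 < l) (h : ℝ≥0) (n : ℕ) :
    HasSubgaussianMGF (fun ω => discreteConv (Real.exp (-l * h)) (fun i => β (i * h) ω) n)
      ((6 * l ^ (-H)) ^ 2).toNNReal P :=
  hasSubgaussianMGF_of_gaussian (hβ.hasGaussianLaw_discreteConv _ _ _)
    (hβ.integral_discreteConv _ _ _) (by positivity) (hβ.eLpNorm_discreteConv_le hH hH1 hl h n)

lemma measurable_discreteConv (ρ : ℝ) (n : ℕ) :
    Measurable fun b : ℕ → ℝ => discreteConv ρ b n := by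
  obtain ⟨c, hc⟩ := exists_discreteConv_eq_linear ρ n
  simp_rw [hc]
  fun_prop

lemma IsCylindricalFBM.iIndepFun_discreteConv {H : ℝ} {β : ℕ → ℝ≥0 → Ω → ℝ}
    (hβ : IsCylindricalFBM H β P) (ρ : ℕ → ℝ) (h : ℝ≥0) (n : ℕ) :
    iIndepFun (fun k ω => discreteConv (ρ k) (fun i => β k (i * h) ω) n) P :=
  hβ.indep.comp (fun k (w : ℝ≥0 → ℝ) => discreteConv (ρ k) (fun i => w (i * h)) n)
    fun k => (measurable_discreteConv (ρ k) n).comp (by fun_prop)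

/-- Absolute moments of sub-Gaussian random variables. -/
lemma lintegral_pow_le_of_hasSubgaussianMGF [IsProbabilityMeasure P] {X : Ω → ℝ} {τ : ℝ}
    (hτ : 0 ≤ τ) (hX : HasSubgaussianMGF X (τ ^ 2).toNNReal P) {r : ℕ} (hr : 1 ≤ r) :
    ∫⁻ ω, ‖X ω‖ₑ ^ r ∂P ≤ ENNReal.ofReal (4 * r.factorial * τ ^ r) := by
  -- The degenerate scale is separated because the exponential moments are evaluated at ±1/τ, where
  -- they are at most e^{1/2} ≤ 2.
  rcases hτ.eq_or_lt with rfl | hτ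
  · have h0 : X =ᵐ[P] 0 := by
      refine HasSubgaussianMGF.ae_eq_zero_of_hasSubgaussianMGF_zero ?_
      simpa using hX
    have h1 : ∫⁻ ω, ‖X ω‖ₑ ^ r ∂P = ∫⁻ ω, 0 ∂P := by
      refine lintegral_congr_ae (h0.mono fun ω hω => ?_)
      simp only [hω, Pi.zero_apply, enorm_zero]
      exact zero_pow (by omega)
    simp [h1]
  · have hm : ∀ t, Integrable (fun ω => Real.exp (t * X ω)) P := hX.integrable_exp_mul
    have hb : ∀ t, t ^ 2 = (τ ^ 2)⁻¹ → ∫ ω, Real.exp (t * X ω) ∂P ≤ 2 := by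
      intro t ht
      refine (hX.mgf_le t).trans ?_
      rw [Real.coe_toNNReal _ (by positivity), ht, mul_inv_cancel₀ (by positivity)]
      have h1 : Real.exp (1 / 2) ^ 2 ≤ 2 ^ 2 := by
        rw [← Real.exp_nat_mul]
        norm_num
        linarith [Real.exp_one_lt_d9]
      exact le_of_sq_le_sq h1 (by norm_num)
    have hle : ∀ ω, ‖X ω‖ₑ ^ r ≤ ENNReal.ofReal (r.factorial * τ ^ r *
        (Real.exp (τ⁻¹ * X ω) + Real.exp (-τ⁻¹ * X ω))) := by
      intro ω
      rw [Real.enorm_eq_ofReal_abs, ← ENNReal.ofReal_pow (abs_nonneg _)]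
      refine ENNReal.ofReal_le_ofReal ?_
      have h1 := Real.pow_div_factorial_le_exp (|X ω| / τ) (by positivity) r
      have h2 : Real.exp (|X ω| / τ) ≤ Real.exp (τ⁻¹ * X ω) + Real.exp (-τ⁻¹ * X ω) := by
        rcases abs_cases (X ω) with ⟨h, -⟩ | ⟨h, -⟩ <;> rw [h]
        · rw [div_eq_inv_mul]; linarith [Real.exp_pos (-τ⁻¹ * X ω)]
        · rw [div_eq_inv_mul, mul_neg, ← neg_mul]; linarith [Real.exp_pos (τ⁻¹ * X ω)]
      rw [div_pow, div_div, div_le_iff₀ (by positivity)] at h1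
      calc |X ω| ^ r ≤ Real.exp (|X ω| / τ) * (τ ^ r * r.factorial) := h1
        _ ≤ _ := by rw [mul_comm]; rw [mul_comm (τ ^ r)]; gcongr
    refine (lintegral_mono hle).trans ?_
    have hint : Integrable (fun ω => (r.factorial : ℝ) * τ ^ r *
        (Real.exp (τ⁻¹ * X ω) + Real.exp (-τ⁻¹ * X ω))) P := ((hm _).add (hm _)).const_mul _
    rw [← ofReal_integral_eq_lintegral_ofReal hint (.of_forall fun ω => by positivity),
      integral_const_mul, integral_add (hm _) (hm _)]
    refine ENNReal.ofReal_le_ofReal ?_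
    have h1 := hb τ⁻¹ (by rw [inv_pow])
    have h2 := hb (-τ⁻¹) (by rw [neg_sq, inv_pow])
    calc _ ≤ (r.factorial : ℝ) * τ ^ r * (2 + 2) := by gcongr
      _ = _ := by ring

lemma eLpNorm_le_of_lintegral_pow_le {E : Type*} [NormedAddCommGroup E] {f : Ω → E} {r : ℕ}
    (hr : 1 ≤ r) {B : ℝ} (hB : 0 ≤ B) (h : ∫⁻ ω, ‖f ω‖ₑ ^ r ∂P ≤ ENNReal.ofReal B) :
    eLpNorm f r P ≤ ENNReal.ofReal (B ^ (1 / (r : ℝ))) := by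
  rw [eLpNorm_eq_lintegral_rpow_enorm_toReal (by exact_mod_cast (by omega : r ≠ 0))
    (ENNReal.natCast_ne_top r)]
  simp only [ENNReal.toReal_natCast, ENNReal.rpow_natCast]
  rw [← ENNReal.ofReal_rpow_of_nonneg hB (by positivity)]
  gcongr

end Probability

/-! ### Supremum norms of random sine polynomials and series. -/

lemma abs_eigenfunction_sub_le (k : ℕ) (ξ η : I) :
    |eigenfunction k ξ - eigenfunction k η| ≤
      Real.sqrt 2 * Real.pi * ((k : ℝ) + 1) * |(ξ : ℝ) - η| := by
  change |Real.sqrt 2 * Real.sin (((k : ℝ) + 1) * Real.pi * ξ) -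
    Real.sqrt 2 * Real.sin (((k : ℝ) + 1) * Real.pi * η)| ≤ _
  have h : |Real.sin (((k : ℝ) + 1) * Real.pi * ξ) - Real.sin (((k : ℝ) + 1) * Real.pi * η)| ≤
      |((k : ℝ) + 1) * Real.pi * ξ - ((k : ℝ) + 1) * Real.pi * η| := by
    simpa [Real.dist_eq] using Real.lipschitzWith_sin.dist_le_mul
      (((k : ℝ) + 1) * Real.pi * ξ) (((k : ℝ) + 1) * Real.pi * η)
  have hp := Real.pi_pos
  rw [← mul_sub, abs_mul, abs_of_nonneg (by positivity : (0 : ℝ) ≤ ((k : ℝ) + 1) * Real.pi)] at h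
  rw [← mul_sub, abs_mul, abs_of_nonneg (Real.sqrt_nonneg 2)]
  calc _ ≤ Real.sqrt 2 * (((k : ℝ) + 1) * Real.pi * |(ξ : ℝ) - η|) := by gcongr
    _ = _ := by ring

/-- The points `i / G` of an equidistant grid. -/
def gridPoint (G i : ℕ) : I := projIcc 0 1 zero_le_one ((i : ℝ) / G)

/-- The supremum norm of a sine polynomial is controlled by its values on a grid. -/
lemma norm_sinePolynomial_le (a : ℕ → ℝ) (s : Finset ℕ) {G r : ℕ} (hG : 0 < G) (hr : 1 ≤ r) :
    ‖∑ k ∈ s, a k • eigenfunction k‖ ≤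
      (∑ i ∈ Finset.range (G + 1),
        |∑ k ∈ s, eigenfunction k (gridPoint G i) * a k| ^ r) ^ (1 / (r : ℝ)) +
      ∑ k ∈ s, (Real.sqrt 2 * Real.pi * ((k : ℝ) + 1) / G) * |a k| := by
  have hp := Real.pi_pos
  rw [ContinuousMap.norm_le _ (by positivity)]
  intro ξ
  have hG' : (0 : ℝ) < G := by exact_mod_cast hG
  -- The nearest grid point to the left of ξ. The value there is bounded by the ℓ^r norm over the
  -- grid, the remainder by the Lipschitz constants of the modes.
  set i := ⌊(G : ℝ) * ξ⌋₊ with hi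
  have hi1 : (i : ℝ) ≤ G * ξ := Nat.floor_le (mul_nonneg hG'.le ξ.2.1)
  have hi2 : (G : ℝ) * ξ < i + 1 := Nat.lt_floor_add_one _
  have hiG : (i : ℝ) ≤ G := hi1.trans (mul_le_of_le_one_right hG'.le ξ.2.2)
  have hgrid : (gridPoint G i : ℝ) = (i : ℝ) / G := by
    rw [gridPoint, projIcc_of_mem]
    exact ⟨by positivity, (div_le_one hG').2 hiG⟩
  have hdist : |(ξ : ℝ) - gridPoint G i| ≤ 1 / G := by
    rw [hgrid, abs_le]
    constructor
    · have : (i : ℝ) / G ≤ ξ := (div_le_iff₀ hG').2 (by linarith)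
      have : (0 : ℝ) ≤ 1 / G := by positivity
      linarith
    · rw [sub_le_iff_le_add, ← add_div, le_div_iff₀ hG']
      linarith
  have happ : ∀ η : I, (∑ k ∈ s, a k • eigenfunction k) η = ∑ k ∈ s, eigenfunction k η * a k := by
    intro η
    simp [ContinuousMap.sum_apply, mul_comm]
  rw [happ, Real.norm_eq_abs]
  have h1 : |∑ k ∈ s, eigenfunction k (gridPoint G i) * a k| ≤ (∑ i ∈ Finset.range (G + 1),
      |∑ k ∈ s, eigenfunction k (gridPoint G i) * a k| ^ r) ^ (1 / (r : ℝ)) := by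
    have hr' : (r : ℝ) ≠ 0 := by exact_mod_cast (by omega : r ≠ 0)
    calc _ = (|∑ k ∈ s, eigenfunction k (gridPoint G i) * a k| ^ r) ^ (1 / (r : ℝ)) := by
          rw [← Real.rpow_natCast, ← Real.rpow_mul (abs_nonneg _), mul_one_div_cancel hr',
            Real.rpow_one]
      _ ≤ _ := by
          refine Real.rpow_le_rpow (by positivity) ?_ (by positivity)
          exact Finset.single_le_sum
            (f := fun i => |∑ k ∈ s, eigenfunction k (gridPoint G i) * a k| ^ r)
            (fun _ _ => by positivity)
            (Finset.mem_range.2 (Nat.lt_succ_of_le (by exact_mod_cast hiG)))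
  have h2 : |∑ k ∈ s, eigenfunction k ξ * a k -
      ∑ k ∈ s, eigenfunction k (gridPoint G i) * a k| ≤
      ∑ k ∈ s, (Real.sqrt 2 * Real.pi * ((k : ℝ) + 1) / G) * |a k| := by
    rw [← Finset.sum_sub_distrib]
    refine (Finset.abs_sum_le_sum_abs _ _).trans (Finset.sum_le_sum fun k _ => ?_)
    rw [← sub_mul, abs_mul]
    refine mul_le_mul_of_nonneg_right ?_ (abs_nonneg _)
    refine (abs_eigenfunction_sub_le k ξ _).trans ?_
    rw [div_eq_mul_one_div]
    gcongr
  have h3 := abs_add_le (∑ k ∈ s, eigenfunction k (gridPoint G i) * a k)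
    (∑ k ∈ s, eigenfunction k ξ * a k - ∑ k ∈ s, eigenfunction k (gridPoint G i) * a k)
  rw [add_sub_cancel] at h3
  linarith

section Probability

variable {Ω : Type*} [MeasurableSpace Ω] {P : Measure Ω}

lemma hasSubgaussianMGF_mono {X : Ω → ℝ} {c d : ℝ≥0} (h : HasSubgaussianMGF X c P)
    (hcd : c ≤ d) : HasSubgaussianMGF X d P :=
  ⟨h.integrable_exp_mul, fun t => (h.mgf_le t).trans (Real.exp_le_exp.2 (by gcongr))⟩

lemma eLpNorm_le_of_hasSubgaussianMGF [IsProbabilityMeasure P] {X : Ω → ℝ} {τ : ℝ}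
    (hτ : 0 ≤ τ) (hX : HasSubgaussianMGF X (τ ^ 2).toNNReal P) {r : ℕ} (hr : 1 ≤ r) :
    eLpNorm X r P ≤ ENNReal.ofReal ((4 * r.factorial : ℝ) ^ (1 / (r : ℝ)) * τ) := by
  refine (eLpNorm_le_of_lintegral_pow_le hr (by positivity)
    (lintegral_pow_le_of_hasSubgaussianMGF hτ hX hr)).trans_eq ?_
  rw [Real.mul_rpow (by positivity) (by positivity), ← Real.rpow_natCast, ← Real.rpow_mul hτ,
    mul_one_div_cancel (by exact_mod_cast (by omega : r ≠ 0)), Real.rpow_one]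

/-- Independence adds the variance proxies, so the scale grows like the square root of the number of
terms; the factor 2 is the squared bound of the eigenfunctions. -/
lemma hasSubgaussianMGF_sum_mul {z : ℕ → Ω → ℝ} (hind : iIndepFun z P) {s : Finset ℕ} {τ v : ℝ}
    (hz : ∀ k ∈ s, HasSubgaussianMGF (z k) (τ ^ 2).toNNReal P) {e : ℕ → ℝ}
    (he : ∀ k, |e k| ≤ Real.sqrt 2) (hv : 2 * s.card * τ ^ 2 ≤ v ^ 2) :
    HasSubgaussianMGF (fun ω => ∑ k ∈ s, e k * z k ω) (v ^ 2).toNNReal P := by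
  have h := HasSubgaussianMGF.sum_of_iIndepFun (s := s) (X := fun k ω => e k * z k ω)
    (hind.comp (fun k x => e k * x) fun k => by fun_prop) (fun k hk => (hz k hk).const_mul (e k))
  refine hasSubgaussianMGF_mono h ?_
  rw [← NNReal.coe_le_coe, Real.coe_toNNReal _ (sq_nonneg v)]
  push_cast
  refine le_trans ?_ hv
  rw [mul_comm (2 : ℝ), mul_assoc, ← nsmul_eq_mul]
  refine Finset.sum_le_card_nsmul _ _ _ fun k _ => ?_
  change e k ^ 2 * ((τ ^ 2).toNNReal : ℝ) ≤ _
  rw [Real.coe_toNNReal _ (sq_nonneg τ)]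
  refine mul_le_mul_of_nonneg_right ?_ (sq_nonneg τ)
  change e k ^ 2 ≤ 2
  rw [← sq_abs, ← Real.sq_sqrt (by norm_num : (0 : ℝ) ≤ 2)]
  exact pow_le_pow_left₀ (abs_nonneg _) (he k) 2

/-- Moments of the supremum norm of random sine polynomials. -/
lemma eLpNorm_sinePolynomial_le [IsProbabilityMeasure P] {z : ℕ → Ω → ℝ} (hind : iIndepFun z P)
    {s : Finset ℕ} {τ v : ℝ} (hτ : 0 ≤ τ) (hv0 : 0 ≤ v)
    (hz : ∀ k ∈ s, HasSubgaussianMGF (z k) (τ ^ 2).toNNReal P)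
    (hv : 2 * s.card * τ ^ 2 ≤ v ^ 2) {G r : ℕ} (hG : 0 < G) (hr : 1 ≤ r) {B : ℝ}
    (hB : ∀ k ∈ s, (k : ℝ) + 1 ≤ B) :
    eLpNorm (fun ω => ∑ k ∈ s, z k ω • eigenfunction k) r P ≤
      ENNReal.ofReal (((G + 1) * (4 * r.factorial) : ℝ) ^ (1 / (r : ℝ)) * v +
        s.card * (Real.sqrt 2 * Real.pi * B / G * ((4 * r.factorial : ℝ) ^ (1 / (r : ℝ)) * τ))) := by
  have hp := Real.pi_pos
  have hr1 : (1 : ℝ≥0∞) ≤ r := by exact_mod_cast hr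
  set Q : Ω → ℝ := fun ω => (∑ i ∈ Finset.range (G + 1),
    |∑ k ∈ s, eigenfunction k (gridPoint G i) * z k ω| ^ r) ^ (1 / (r : ℝ)) with hQ
  set D : ℕ → Ω → ℝ := fun k ω => (Real.sqrt 2 * Real.pi * ((k : ℝ) + 1) / G) * |z k ω| with hD
  have hzm : ∀ k ∈ s, AEMeasurable (z k) P := fun k hk => (hz k hk).aemeasurable
  have hXm : ∀ i, AEMeasurable (fun ω => ∑ k ∈ s, eigenfunction k (gridPoint G i) * z k ω) P :=
    fun i => Finset.aemeasurable_fun_sum s fun k hk => (hzm k hk).const_mul _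
  have hQm : AEStronglyMeasurable Q P := by
    refine AEMeasurable.aestronglyMeasurable ?_
    refine AEMeasurable.pow_const (Finset.aemeasurable_fun_sum _ fun i _ => ?_) _
    exact (continuous_abs.measurable.comp_aemeasurable (hXm i)).pow_const r
  have hDm : ∀ k ∈ s, AEStronglyMeasurable (D k) P := fun k hk =>
    ((continuous_abs.measurable.comp_aemeasurable (hzm k hk)).const_mul _).aestronglyMeasurable
  have hQle : eLpNorm Q r P ≤
      ENNReal.ofReal (((G + 1) * (4 * r.factorial) : ℝ) ^ (1 / (r : ℝ)) * v) := by
    have hQr : ∀ ω, ‖Q ω‖ₑ ^ r = ∑ i ∈ Finset.range (G + 1),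
        ‖∑ k ∈ s, eigenfunction k (gridPoint G i) * z k ω‖ₑ ^ r := by
      intro ω
      rw [Real.enorm_of_nonneg (by positivity), ← ENNReal.ofReal_pow (by positivity), hQ,
        ← Real.rpow_natCast, ← Real.rpow_mul (by positivity),
        one_div_mul_cancel (by exact_mod_cast (by omega : r ≠ 0)), Real.rpow_one,
        ENNReal.ofReal_sum_of_nonneg fun i _ => by positivity]
      refine Finset.sum_congr rfl fun i _ => ?_
      rw [Real.enorm_eq_ofReal_abs, ENNReal.ofReal_pow (abs_nonneg _)]
    refine (eLpNorm_le_of_lintegral_pow_le (B := (G + 1) * (4 * r.factorial * v ^ r)) hr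
      (by positivity) ?_).trans_eq ?_
    · simp_rw [hQr]
      rw [lintegral_finsetSum' _ fun i _ => ((hXm i).enorm.pow_const r)]
      refine (Finset.sum_le_card_nsmul _ _ (ENNReal.ofReal (4 * r.factorial * v ^ r))
        fun i _ => ?_).trans_eq ?_
      · exact lintegral_pow_le_of_hasSubgaussianMGF hv0 (hasSubgaussianMGF_sum_mul hind hz
          (fun k => abs_eigenfunction_apply_le k _) hv) hr
      · rw [Finset.card_range, nsmul_eq_mul, ENNReal.ofReal_mul (p := (G : ℝ) + 1) (by positivity)]
        congr 1
        rw [← Nat.cast_succ, ENNReal.ofReal_natCast]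
    · rw [← mul_assoc, Real.mul_rpow (by positivity) (by positivity), ← Real.rpow_natCast,
        ← Real.rpow_mul hv0, mul_one_div_cancel (by exact_mod_cast (by omega : r ≠ 0)),
        Real.rpow_one]
  have hDle : ∀ k ∈ s, eLpNorm (D k) r P ≤ ENNReal.ofReal
      (Real.sqrt 2 * Real.pi * B / G * ((4 * r.factorial : ℝ) ^ (1 / (r : ℝ)) * τ)) := by
    intro k hk
    have h1 := eLpNorm_const_smul (Real.sqrt 2 * Real.pi * ((k : ℝ) + 1) / G)
      (fun ω => |z k ω|) r P
    refine (le_of_eq h1).trans ?_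
    rw [Real.enorm_of_nonneg (by positivity), ENNReal.ofReal_mul (by
      have := hB k hk
      have : (0 : ℝ) ≤ B := le_trans (by positivity) this
      positivity)]
    have h2 : eLpNorm (fun ω => |z k ω|) r P = eLpNorm (z k) r P := eLpNorm_norm (z k)
    rw [h2]
    have := hB k hk
    exact mul_le_mul' (ENNReal.ofReal_le_ofReal (by gcongr))
      (eLpNorm_le_of_hasSubgaussianMGF hτ (hz k hk) hr)
  have hle : eLpNorm (fun ω => ∑ k ∈ s, z k ω • eigenfunction k) r P ≤
      eLpNorm (Q + ∑ k ∈ s, D k) r P := by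
    refine eLpNorm_mono_real fun ω => ?_
    have := norm_sinePolynomial_le (fun k => z k ω) s hG hr
    simpa [hQ, hD] using this
  refine hle.trans ((eLpNorm_add_le hQm (Finset.aestronglyMeasurable_sum s hDm) hr1).trans ?_)
  -- Positivity of `B` comes from an element of `s`; without one the second term vanishes.
  rcases s.eq_empty_or_nonempty with rfl | ⟨k₀, hk₀⟩
  · simpa using hQle
  have hB0 : (0 : ℝ) ≤ B := le_trans (by positivity) (hB k₀ hk₀)
  rw [ENNReal.ofReal_add (by positivity) (by positivity)]
  refine add_le_add hQle ((eLpNorm_sum_le hDm hr1).trans ?_)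
  refine (Finset.sum_le_card_nsmul _ _ _ hDle).trans_eq ?_
  rw [nsmul_eq_mul, ENNReal.ofReal_mul (p := (s.card : ℝ)) (by positivity),
    ENNReal.ofReal_natCast]

end Probability

/-- The number is the ratio of the dyadic geometric series: 2/r is the cost of the grid, 1/2 − α the
decay of a block. -/
lemma exists_large_exponent {α : ℝ} (hα : 1 / 2 < α) (r₀ : ℕ) :
    ∃ r : ℕ, r₀ ≤ r ∧ 1 ≤ r ∧ (2 : ℝ) ^ (2 / (r : ℝ) + (1 / 2 - α)) < 1 := by
  obtain ⟨n, hn⟩ := exists_nat_gt (2 / (α - 1 / 2))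
  refine ⟨max r₀ (n + 1), le_max_left _ _, le_trans (by omega) (le_max_right _ _), ?_⟩
  refine Real.rpow_lt_one_of_one_lt_of_neg one_lt_two ?_
  have h1 : 0 < α - 1 / 2 := by linarith
  have h2 : (n : ℝ) < (max r₀ (n + 1) : ℕ) := by
    exact_mod_cast lt_of_lt_of_le (Nat.lt_succ_self n) (le_max_right _ _)
  have h3 := hn.trans h2
  have h4 : (0 : ℝ) < (max r₀ (n + 1) : ℕ) := lt_trans (by positivity) h3
  have h5 : 2 / ((max r₀ (n + 1) : ℕ) : ℝ) < α - 1 / 2 := by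
    rw [div_lt_iff₀ h4, mul_comm]
    rwa [div_lt_iff₀ h1] at h3
  linarith

section Probability

variable {Ω : Type*} [MeasurableSpace Ω] {P : Measure Ω}

/-- With 4^m grid cells the grid maximum costs 4^{m/r}, and a sum of 2^m independent terms has scale
2^{m(1/2 − α)}. Off the grid, 2^m terms with Lipschitz constant of order 2^m and mesh 4^{-m}
contribute only 2^{-αm}. -/
lemma eLpNorm_dyadicBlock_le [IsProbabilityMeasure P] {z : ℕ → Ω → ℝ} (hind : iIndepFun z P)
    {α c : ℝ} (hα : 0 ≤ α) (hc : 0 ≤ c)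
    (hz : ∀ k : ℕ, HasSubgaussianMGF (z k) ((c * ((k : ℝ) + 1) ^ (-α)) ^ 2).toNNReal P)
    {r : ℕ} (hr : 1 ≤ r) (m : ℕ) :
    eLpNorm (fun ω => ∑ k ∈ Finset.Ico (2 ^ m) (2 ^ (m + 1)), z k ω • eigenfunction k) r P ≤
      ENNReal.ofReal (((8 * r.factorial : ℝ) ^ (1 / (r : ℝ)) * (Real.sqrt 2 * c) +
        2 * (Real.sqrt 2 * Real.pi) * ((4 * r.factorial : ℝ) ^ (1 / (r : ℝ)) * c)) *
        ((2 : ℝ) ^ (2 / (r : ℝ) + (1 / 2 - α))) ^ m) := by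
  have hp := Real.pi_pos
  have hcard : (Finset.Ico (2 ^ m) (2 ^ (m + 1)) : Finset ℕ).card = 2 ^ m := by
    rw [Nat.card_Ico, pow_succ]; omega
  have h2m : (0 : ℝ) < 2 ^ m := by positivity
  have hpow : ∀ x : ℝ, ((2 : ℝ) ^ m) ^ x = (2 : ℝ) ^ (x * m) := fun x => by
    rw [← Real.rpow_natCast, ← Real.rpow_mul two_pos.le, mul_comm]
  set τ : ℝ := c * ((2 : ℝ) ^ m) ^ (-α) with hτ
  set v : ℝ := Real.sqrt 2 * c * ((2 : ℝ) ^ m) ^ (1 / 2 - α) with hv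
  have hz' : ∀ k ∈ Finset.Ico (2 ^ m) (2 ^ (m + 1)),
      HasSubgaussianMGF (z k) (τ ^ 2).toNNReal P := by
    intro k hk
    refine hasSubgaussianMGF_mono (hz k) (Real.toNNReal_le_toNNReal ?_)
    have hk' : (2 : ℝ) ^ m ≤ (k : ℝ) + 1 := by
      have : (2 : ℝ) ^ m ≤ k := by exact_mod_cast (Finset.mem_Ico.1 hk).1
      linarith
    have := Real.rpow_le_rpow_of_nonpos h2m hk' (neg_nonpos.2 hα)
    exact pow_le_pow_left₀ (by positivity) (mul_le_mul_of_nonneg_left this hc) 2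
  have hvv : 2 * ((Finset.Ico (2 ^ m) (2 ^ (m + 1)) : Finset ℕ).card : ℝ) * τ ^ 2 ≤ v ^ 2 := by
    rw [hcard, hv, hτ, mul_pow, mul_pow, mul_pow, Real.sq_sqrt two_pos.le, Real.rpow_sub h2m,
      Real.rpow_neg h2m.le, div_pow, ← Real.sqrt_eq_rpow, Real.sq_sqrt h2m.le]
    push_cast
    refine le_of_eq ?_
    field_simp
  have hB : ∀ k ∈ (Finset.Ico (2 ^ m) (2 ^ (m + 1)) : Finset ℕ), (k : ℝ) + 1 ≤ 2 * 2 ^ m := by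
    intro k hk
    have := (Finset.mem_Ico.1 hk).2
    rw [pow_succ'] at this
    exact_mod_cast Nat.succ_le_of_lt this
  refine (eLpNorm_sinePolynomial_le hind (by positivity) (by positivity) hz' hvv
    (G := 4 ^ m) (by positivity) hr hB).trans (ENNReal.ofReal_le_ofReal ?_)
  have h4 : (4 : ℝ) ^ m = 2 ^ m * 2 ^ m := by rw [← mul_pow]; norm_num
  have hq : ((2 : ℝ) ^ (2 / (r : ℝ) + (1 / 2 - α))) ^ m =
      ((2 : ℝ) ^ m) ^ (2 / (r : ℝ) + (1 / 2 - α)) := by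
    rw [hpow, ← Real.rpow_natCast, ← Real.rpow_mul two_pos.le]
  rw [hq, add_mul ((8 * r.factorial : ℝ) ^ (1 / (r : ℝ)) * (Real.sqrt 2 * c)), hcard]
  push_cast
  apply add_le_add
  -- The constant 8 comes from 4^m + 1 ≤ 2 · 4^m.
  · have h1 : (((4 : ℝ) ^ m + 1) * (4 * r.factorial)) ^ (1 / (r : ℝ)) ≤
        (8 * r.factorial : ℝ) ^ (1 / (r : ℝ)) * ((2 : ℝ) ^ m) ^ (2 / (r : ℝ)) := by
      have e : ((2 : ℝ) ^ m) ^ (2 / (r : ℝ)) = ((4 : ℝ) ^ m) ^ (1 / (r : ℝ)) := by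
        rw [h4, Real.mul_rpow h2m.le h2m.le, ← Real.rpow_add h2m]
        congr 1
        ring
      rw [e, ← Real.mul_rpow (by positivity) (by positivity)]
      refine Real.rpow_le_rpow (by positivity) ?_ (by positivity)
      have : (1 : ℝ) ≤ 4 ^ m := one_le_pow₀ (by norm_num)
      have hf : (0 : ℝ) < r.factorial := by positivity
      nlinarith
    rw [Real.rpow_add h2m, hv]
    calc _ ≤ (8 * r.factorial : ℝ) ^ (1 / (r : ℝ)) * ((2 : ℝ) ^ m) ^ (2 / (r : ℝ)) *
          (Real.sqrt 2 * c * ((2 : ℝ) ^ m) ^ (1 / 2 - α)) := by gcongr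
      _ = _ := by ring
  · have h1 : ((2 : ℝ) ^ m) ^ (-α) ≤ ((2 : ℝ) ^ m) ^ (2 / (r : ℝ) + (1 / 2 - α)) := by
      refine Real.rpow_le_rpow_of_exponent_le (one_le_pow₀ one_le_two) ?_
      have : (0 : ℝ) ≤ 2 / (r : ℝ) := by positivity
      linarith
    calc _ = 2 * (Real.sqrt 2 * Real.pi) * ((4 * r.factorial : ℝ) ^ (1 / (r : ℝ)) * c) *
          ((2 : ℝ) ^ m) ^ (-α) := by
          rw [hτ, h4]
          field_simp
      _ ≤ _ := by gcongr

end Probability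

/-- Moment bounds in the supremum norm for random sine series with independent sub-Gaussian
coefficients whose variance proxies decay faster than `1 / k`. -/
theorem exists_eLpNorm_sineSeries_le {α c : ℝ} (hα : 1 / 2 < α) (hc : 0 ≤ c) (r₀ : ℕ) :
    ∃ M : ℝ, 0 ≤ M ∧ ∀ (Ω : Type*) [MeasurableSpace Ω] (P : Measure Ω) [IsProbabilityMeasure P]
      (z : ℕ → Ω → ℝ), iIndepFun z P →
      (∀ k : ℕ, HasSubgaussianMGF (z k) ((c * ((k : ℝ) + 1) ^ (-α)) ^ 2).toNNReal P) →
      (∀ᵐ ω ∂P, Summable fun k => |z k ω|) →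
      eLpNorm (fun ω => sineSeries fun k => z k ω) r₀ P ≤ ENNReal.ofReal M := by
  obtain ⟨r, hr₀, hr, hq⟩ := exists_large_exponent hα r₀
  set q : ℝ := (2 : ℝ) ^ (2 / (r : ℝ) + (1 / 2 - α)) with hq_def
  have hq0 : 0 ≤ q := by positivity
  set K : ℝ := (8 * r.factorial : ℝ) ^ (1 / (r : ℝ)) * (Real.sqrt 2 * c) +
        2 * (Real.sqrt 2 * Real.pi) * ((4 * r.factorial : ℝ) ^ (1 / (r : ℝ)) * c) with hK
  have hp := Real.pi_pos
  have hK0 : 0 ≤ K := by positivity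
  -- Bound for the mode of index 0, which lies in no block [2^m, 2^(m+1)).
  set K₀ : ℝ := Real.sqrt 2 * ((4 * r.factorial : ℝ) ^ (1 / (r : ℝ)) * c) with hK₀
  have hK₀0 : 0 ≤ K₀ := by positivity
  have h1q : 0 < 1 - q := by linarith
  refine ⟨K₀ + K * (1 - q)⁻¹, by positivity, ?_⟩
  intro Ω _ P _ z hind hz hsum
  have hr1 : (1 : ℝ≥0∞) ≤ r := by exact_mod_cast hr
  have hzm : ∀ k, AEStronglyMeasurable (fun ω => z k ω • eigenfunction k) P := fun k =>
    (hz k).aestronglyMeasurable.smul_const _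
  have hSm : ∀ s : Finset ℕ, AEStronglyMeasurable (fun ω => ∑ k ∈ s, z k ω • eigenfunction k) P :=
    fun s => Finset.aestronglyMeasurable_fun_sum s fun k _ => hzm k
  have hbound : ∀ m : ℕ, eLpNorm (fun ω => ∑ k ∈ Finset.range (2 ^ m), z k ω • eigenfunction k)
      r P ≤ ENNReal.ofReal (K₀ + K * ∑ i ∈ Finset.range m, q ^ i) := by
    intro m
    induction m with
    | zero =>
      simp only [pow_zero, Finset.range_one, Finset.sum_singleton, Finset.range_zero,
        Finset.sum_empty, mul_zero, add_zero]
      have h0 := eLpNorm_le_of_hasSubgaussianMGF (by positivity) (hz 0) hr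
      have h1 : eLpNorm (fun ω => z 0 ω • eigenfunction 0) r P ≤
          eLpNorm (Real.sqrt 2 • z 0) r P := by
        refine eLpNorm_mono fun ω => ?_
        rw [norm_smul, Pi.smul_apply, norm_smul, mul_comm, Real.norm_of_nonneg (Real.sqrt_nonneg 2)]
        exact mul_le_mul_of_nonneg_right (norm_eigenfunction_le 0) (norm_nonneg _)
      refine h1.trans ?_
      rw [eLpNorm_const_smul, Real.enorm_of_nonneg (Real.sqrt_nonneg 2), hK₀,
        ENNReal.ofReal_mul (Real.sqrt_nonneg 2)]
      simp only [Nat.cast_zero, zero_add, Real.one_rpow, mul_one] at h0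
      gcongr
    | succ m ih =>
      have e : (fun ω => ∑ k ∈ Finset.range (2 ^ (m + 1)), z k ω • eigenfunction k) =
          (fun ω => ∑ k ∈ Finset.range (2 ^ m), z k ω • eigenfunction k) +
          fun ω => ∑ k ∈ Finset.Ico (2 ^ m) (2 ^ (m + 1)), z k ω • eigenfunction k := by
        ext1 ω
        exact (Finset.sum_range_add_sum_Ico _ (pow_le_pow_right₀ one_le_two m.le_succ)).symm
      rw [e, Finset.sum_range_succ, mul_add, ← add_assoc, ENNReal.ofReal_add (by positivity)
        (by positivity)]
      exact (eLpNorm_add_le (hSm _) (hSm _) hr1).trans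
        (add_le_add ih (eLpNorm_dyadicBlock_le hind (by linarith) hc hz hr m))
  have hlim : ∀ᵐ ω ∂P, Filter.Tendsto
      (fun m : ℕ => ∑ k ∈ Finset.range (2 ^ m), z k ω • eigenfunction k) Filter.atTop
      (nhds (sineSeries fun k => z k ω)) := by
    filter_upwards [hsum] with ω hω
    exact (hasSum_sineSeries hω).tendsto_sum_nat.comp
      (tendsto_pow_atTop_atTop_of_one_lt one_lt_two)
  have hmeas : AEStronglyMeasurable (fun ω => sineSeries fun k => z k ω) P :=
    aestronglyMeasurable_of_tendsto_ae Filter.atTop (fun m => hSm (Finset.range (2 ^ m))) hlim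
  have hmain : eLpNorm (fun ω => sineSeries fun k => z k ω) r P ≤
      ENNReal.ofReal (K₀ + K * (1 - q)⁻¹) := by
    -- Fatou along the partial sums of length 2^m; the exponent is lowered from `r` to `r₀` at the
    -- end.
    refine Lp.eLpNorm_le_of_ae_tendsto (.of_forall fun m => (hbound m).trans ?_)
      (fun m => hSm (Finset.range (2 ^ m))) hlim
    refine ENNReal.ofReal_le_ofReal ?_
    have h1 : ∑ i ∈ Finset.range m, q ^ i ≤ (1 - q)⁻¹ := by
      rw [← tsum_geometric_of_lt_one hq0 hq]
      exact (summable_geometric_of_lt_one hq0 hq).sum_le_tsum _ fun _ _ => by positivity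
    gcongr
  exact (eLpNorm_le_eLpNorm_of_exponent_le (by exact_mod_cast hr₀) hmeas).trans hmain

/-! ### One step of the scheme and the discrete Grönwall inequality. -/

lemma continuous_heat {t : ℝ} (ht : 0 < t) : Continuous (heat t) :=
  (LipschitzWith.of_dist_le_mul (K := 1) fun x y => by
    rw [dist_eq_norm, dist_eq_norm, ← heat_sub ht, NNReal.coe_one, one_mul]
    exact norm_heat_le ht _).continuous

lemma continuous_integratedHeat {t : ℝ} (ht : 0 < t) : Continuous (integratedHeat t) :=
  (LipschitzWith.of_dist_le_mul (K := ⟨t, ht.le⟩) fun x y => by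
    rw [dist_eq_norm, dist_eq_norm, ← integratedHeat_sub ht]
    exact norm_integratedHeat_le ht _).continuous

lemma superposition_apply {g : ℝ → ℝ} (hg : Continuous g) (x : CSpace) (ξ : I) :
    superposition g x ξ = g (x ξ) := by
  rw [superposition, dif_pos hg]
  rfl

lemma continuous_superposition {g : ℝ → ℝ} (hg : Continuous g) : Continuous (superposition g) := by
  have h : superposition g = (⟨g, hg⟩ : C(ℝ, ℝ)).comp := by
    ext1 x
    rw [superposition, dif_pos hg]
  rw [h]
  exact ContinuousMap.continuous_postcomp _

lemma IsGloballyLipschitz.continuous {g : ℝ → ℝ} (hg : IsGloballyLipschitz g) : Continuous g := by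
  obtain ⟨L, hL, h⟩ := hg
  exact (LipschitzWith.of_dist_le_mul (K := ⟨L, hL⟩) fun y z => h z y).continuous

/-- The deterministic part of one step of the splitting scheme. -/
def schemeStep (f g : ℝ → ℝ) (t : ℝ) (x : CSpace) : CSpace :=
  heat t (superposition (flow f t) x) + integratedHeat t (superposition g x)

lemma continuous_schemeStep {f g : ℝ → ℝ} (hf : IsOneSidedLipschitz f)
    (hg : IsGloballyLipschitz g) {t : ℝ} (ht : 0 < t) : Continuous (schemeStep f g t) :=
  ((continuous_heat ht).comp (continuous_superposition (continuous_flow hf ht.le))).add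
    ((continuous_integratedHeat ht).comp (continuous_superposition hg.continuous))

/-- One step of the scheme, compared with one step of the linear equation. -/
lemma exists_norm_schemeStep_sub_le {f g : ℝ → ℝ} (hf : IsOneSidedLipschitz f)
    (hg : IsGloballyLipschitz g) (T : ℝ) :
    ∃ (c K : ℝ) (m : ℕ), 0 ≤ c ∧ 0 ≤ K ∧ 1 ≤ m ∧ ∀ t, 0 < t → t ≤ T → ∀ x z : CSpace,
      ‖schemeStep f g t x - heat t z‖ ≤
        Real.exp (c * t) * ‖x - z‖ + t * (K * (1 + ‖z‖) ^ m) := by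
  obtain ⟨L, K, m, hL, hK, hm, hflow⟩ := exists_flow_bounds hf T
  have hgc := hg.continuous
  obtain ⟨Lg, hLg, hgl⟩ := hg
  refine ⟨L + Lg, K + |g 0| + Lg, m, by positivity, by positivity, hm, fun t ht htT x z => ?_⟩
  obtain ⟨h1, h2⟩ := hflow t ⟨ht.le, htT⟩
  have hfc := continuous_flow hf ht.le
  have hz := norm_nonneg z
  have hΦ : ‖superposition (flow f t) x - z‖ ≤
      Real.exp (L * t) * ‖x - z‖ + t * (K * (1 + ‖z‖) ^ m) := by
    rw [ContinuousMap.norm_le _ (by positivity)]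
    intro ξ
    rw [ContinuousMap.sub_apply, superposition_apply hfc, Real.norm_eq_abs]
    have e1 := h1 (x ξ) (z ξ)
    have e2 := h2 (z ξ)
    have e3 : |x ξ - z ξ| ≤ ‖x - z‖ := (x - z).norm_coe_le_norm ξ
    have e4 : |z ξ| ≤ ‖z‖ := z.norm_coe_le_norm ξ
    calc |flow f t (x ξ) - z ξ|
        = |(flow f t (x ξ) - flow f t (z ξ)) + (flow f t (z ξ) - z ξ)| := by ring_nf
      _ ≤ _ := abs_add_le _ _
      _ ≤ Real.exp (L * t) * |x ξ - z ξ| + t * (K * (1 + |z ξ|) ^ m) := add_le_add e1 e2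
      _ ≤ _ := by gcongr
  have hG : ‖superposition g x‖ ≤ |g 0| + Lg * (‖x - z‖ + ‖z‖) := by
    rw [ContinuousMap.norm_le _ (by positivity)]
    intro ξ
    rw [superposition_apply hgc, Real.norm_eq_abs]
    have e1 := hgl 0 (x ξ)
    rw [sub_zero] at e1
    have e2 : |x ξ| ≤ ‖x - z‖ + ‖z‖ := by
      refine (x.norm_coe_le_norm ξ).trans ?_
      simpa using norm_add_le (x - z) z
    calc |g (x ξ)| = |g 0 + (g (x ξ) - g 0)| := by ring_nf
      _ ≤ _ := abs_add_le _ _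
      _ ≤ |g 0| + Lg * |x ξ| := by gcongr
      _ ≤ _ := by gcongr
  have hsplit : schemeStep f g t x - heat t z =
      heat t (superposition (flow f t) x - z) + integratedHeat t (superposition g x) := by
    rw [schemeStep, heat_sub ht]
    abel
  -- The Lipschitz part of `g` is absorbed into the rate. The prefactor has to be a pure exponential
  -- e^{ct}, because it is iterated once per time step.
  have hexp : Real.exp (L * t) + t * Lg ≤ Real.exp ((L + Lg) * t) := by
    have e1 : 1 ≤ Real.exp (L * t) := Real.one_le_exp (by positivity)
    have e2 := Real.add_one_le_exp (Lg * t)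
    rw [add_mul, Real.exp_add]
    nlinarith [mul_nonneg hLg ht.le]
  have hpow : (1 : ℝ) + ‖z‖ ≤ (1 + ‖z‖) ^ m := le_self_pow₀ (by linarith) (by omega)
  rw [hsplit]
  calc _ ≤ ‖superposition (flow f t) x - z‖ + t * ‖superposition g x‖ :=
        (norm_add_le _ _).trans (add_le_add (norm_heat_le ht _) (norm_integratedHeat_le ht _))
    _ ≤ (Real.exp (L * t) * ‖x - z‖ + t * (K * (1 + ‖z‖) ^ m)) +
        t * (|g 0| + Lg * (‖x - z‖ + ‖z‖)) := by gcongr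
    _ = (Real.exp (L * t) + t * Lg) * ‖x - z‖ +
        t * (K * (1 + ‖z‖) ^ m + |g 0| * 1 + Lg * ‖z‖) := by ring
    _ ≤ Real.exp ((L + Lg) * t) * ‖x - z‖ +
        t * (K * (1 + ‖z‖) ^ m + |g 0| * (1 + ‖z‖) ^ m + Lg * (1 + ‖z‖) ^ m) := by
        gcongr
        · linarith
        · linarith
    _ = _ := by ring

lemma le_exp_mul_of_step {y ζ : ℕ → ℝ} {c h K : ℝ} {N : ℕ} (hch : 0 ≤ c * h) (hK : 0 ≤ h * K)
    (hζ : ∀ n, 0 ≤ ζ n)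
    (hstep : ∀ n < N, y (n + 1) ≤ Real.exp (c * h) * y n + h * (K * ζ n)) {n : ℕ} (hn : n ≤ N) :
    y n ≤ Real.exp (n * (c * h)) * (y 0 + h * K * ∑ j ∈ Finset.range n, ζ j) := by
  induction n with
  | zero => simp
  | succ n ih =>
    have h1 := hstep n hn
    have h2 := ih (by omega)
    have h3 : 1 ≤ Real.exp (((n + 1 : ℕ) : ℝ) * (c * h)) := Real.one_le_exp (by positivity)
    have h4 : Real.exp (((n + 1 : ℕ) : ℝ) * (c * h)) =
        Real.exp (c * h) * Real.exp (n * (c * h)) := by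
      rw [← Real.exp_add]; congr 1; push_cast; ring
    rw [Finset.sum_range_succ]
    calc y (n + 1) ≤ Real.exp (c * h) * (Real.exp (n * (c * h)) *
          (y 0 + h * K * ∑ j ∈ Finset.range n, ζ j)) + 1 * (h * K * ζ n) := by
          refine h1.trans ?_
          rw [one_mul, ← mul_assoc h K]
          gcongr
      _ ≤ Real.exp (c * h) * (Real.exp (n * (c * h)) *
          (y 0 + h * K * ∑ j ∈ Finset.range n, ζ j)) +
          Real.exp (((n + 1 : ℕ) : ℝ) * (c * h)) * (h * K * ζ n) := by
          have := mul_nonneg hK (hζ n)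
          gcongr
      _ = _ := by rw [h4]; ring

/-! ### From the L² formulation to a recursion in C([0,1]). -/

section Scheme

variable {Ω : Type*}

/-- The Fourier coefficients of the smoothed increment of the noise in the `n`-th step. -/
def noiseCoeff (β : ℕ → ℝ≥0 → Ω → ℝ) (h : ℝ≥0) (n : ℕ) (ω : Ω) (k : ℕ) : ℝ :=
  Real.exp (-eigenvalue k * h) * (β k (((n + 1 : ℕ) : ℝ≥0) * h) ω - β k ((n : ℝ≥0) * h) ω)

/-- The Fourier coefficients of the discrete stochastic convolution. -/
def convCoeff (β : ℕ → ℝ≥0 → Ω → ℝ) (h : ℝ≥0) (n : ℕ) (ω : Ω) (k : ℕ) : ℝ :=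
  discreteConv (Real.exp (-eigenvalue k * h)) (fun i => β k (i * h) ω) n

lemma convCoeff_zero (β : ℕ → ℝ≥0 → Ω → ℝ) (h : ℝ≥0) (ω : Ω) (k : ℕ) :
    convCoeff β h 0 ω k = 0 := rfl

lemma convCoeff_succ (β : ℕ → ℝ≥0 → Ω → ℝ) (h : ℝ≥0) (n : ℕ) (ω : Ω) (k : ℕ) :
    convCoeff β h (n + 1) ω k =
      Real.exp (-eigenvalue k * h) * convCoeff β h n ω k + noiseCoeff β h n ω k := by
  simp only [convCoeff, noiseCoeff, discreteConv]
  ring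

lemma summable_convCoeff {β : ℕ → ℝ≥0 → Ω → ℝ} {h : ℝ≥0} {ω : Ω}
    (hω : ∀ n, Summable fun k => |noiseCoeff β h n ω k|) (n : ℕ) :
    Summable fun k => |convCoeff β h n ω k| := by
  induction n with
  | zero => simp [convCoeff_zero]
  | succ n ih =>
    refine (ih.add (hω n)).of_nonneg_of_le (fun _ => abs_nonneg _) fun k => ?_
    rw [convCoeff_succ]
    refine (abs_add_le _ _).trans (add_le_add ?_ le_rfl)
    rw [abs_mul, Real.abs_exp]
    refine mul_le_of_le_one_left (abs_nonneg _) (Real.exp_le_one_iff.2 ?_)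
    have := mul_nonneg (eigenvalue_pos k).le (NNReal.coe_nonneg h)
    linarith

/-- The convolution carries the same noise term as the scheme, so the noise cancels in the
difference of the two. -/
lemma sineSeries_convCoeff_succ {β : ℕ → ℝ≥0 → Ω → ℝ} {h : ℝ≥0} (hh : 0 < h) {ω : Ω}
    (hω : ∀ n, Summable fun k => |noiseCoeff β h n ω k|) (n : ℕ) :
    sineSeries (convCoeff β h (n + 1) ω) =
      heat h (sineSeries (convCoeff β h n ω)) + sineSeries (noiseCoeff β h n ω) := by
  have hh' : (0 : ℝ) < h := hh
  have h1 := summable_heat hh' (sineSeries (convCoeff β h n ω))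
  simp only [coeff_sineSeries (summable_convCoeff hω n)] at h1
  rw [heat_sineSeries _ (summable_convCoeff hω n), ← sineSeries_add h1 (hω n)]
  congr 1
  ext1 k
  exact convCoeff_succ _ _ _ _ _

lemma isSmoothedIncrement_iff {β : ℕ → ℝ≥0 → Ω → ℝ} {h : ℝ≥0} {ω : Ω} {n : ℕ}
    (hω : Summable fun k => |noiseCoeff β h n ω k|) (V : L2Space) :
    IsSmoothedIncrement β h ((n : ℝ≥0) * h) (((n + 1 : ℕ) : ℝ≥0) * h) ω V ↔
      V = embed (sineSeries (noiseCoeff β h n ω)) := by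
  have h1 := hasSum_embed_sineSeries hω
  have h2 : (fun k => noiseCoeff β h n ω k • basisVec k) = fun k : ℕ =>
      (β k (((n + 1 : ℕ) : ℝ≥0) * h) ω - β k ((n : ℝ≥0) * h) ω) • semigroup h (basisVec k) := by
    ext1 k
    rw [semigroup_basisVec, smul_smul, noiseCoeff, mul_comm]
  rw [h2] at h1
  exact ⟨fun hV => hV.unique h1, fun hV => hV ▸ h1⟩

/-- All terms lie in the range of the injective map `embed`. One direction constructs a solution,
the other puts an arbitrary solution in explicit form. -/
lemma step_iff {f g : ℝ → ℝ} {β : ℕ → ℝ≥0 → Ω → ℝ} {h : ℝ≥0} (hh : 0 < h) {ω : Ω} {n : ℕ}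
    (hω : Summable fun k => |noiseCoeff β h n ω k|) (x y : CSpace) :
    (∃ V : L2Space, IsSmoothedIncrement β h ((n : ℝ≥0) * h) (((n + 1 : ℕ) : ℝ≥0) * h) ω V ∧
      embed y = semigroup h (embed (superposition (flow f h) x)) +
        invA (embed (superposition g x) - semigroup h (embed (superposition g x))) + V) ↔
      y = schemeStep f g h x + sineSeries (noiseCoeff β h n ω) := by
  have hh' : (0 : ℝ) < h := hh
  simp only [isSmoothedIncrement_iff hω, exists_eq_left]
  rw [← embed_integratedHeat hh', ← embed_heat hh', ← map_add, ← map_add]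
  exact embed_injective.eq_iff

end Scheme

section Probability

variable {Ω : Type*} [MeasurableSpace Ω] {P : Measure Ω}

lemma aestronglyMeasurable_sineSeries {z : ℕ → Ω → ℝ}
    (hz : ∀ k, Measurable (z k)) (hsum : ∀ᵐ ω ∂P, Summable fun k => |z k ω|) :
    AEStronglyMeasurable (fun ω => sineSeries fun k => z k ω) P := by
  refine aestronglyMeasurable_of_tendsto_ae Filter.atTop
    (f := fun n ω => ∑ k ∈ Finset.range n, z k ω • eigenfunction k) (fun n => ?_) ?_
  · exact Finset.aestronglyMeasurable_fun_sum _ fun k _ =>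
      (hz k).aestronglyMeasurable.smul_const _
  · filter_upwards [hsum] with ω hω
    exact (hasSum_sineSeries hω).tendsto_sum_nat

lemma ae_summable_abs_of_lintegral_le {z : ℕ → Ω → ℝ} (hz : ∀ k, Measurable (z k)) {b : ℕ → ℝ}
    (hb0 : ∀ k, 0 ≤ b k) (hb : Summable b)
    (hle : ∀ k, ∫⁻ ω, ‖z k ω‖ₑ ∂P ≤ ENNReal.ofReal (b k)) :
    ∀ᵐ ω ∂P, Summable fun k => |z k ω| := by
  have h1 : ∫⁻ ω, ∑' k, ‖z k ω‖ₑ ∂P ≠ ⊤ := by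
    rw [lintegral_tsum fun k => (hz k).enorm.aemeasurable]
    refine ne_top_of_le_ne_top ?_ (ENNReal.tsum_le_tsum hle)
    rw [← ENNReal.ofReal_tsum_of_nonneg hb0 hb]
    exact ENNReal.ofReal_ne_top
  have h2 := ae_lt_top' (AEMeasurable.tsum fun k => (hz k).enorm.aemeasurable) h1
  filter_upwards [h2] with ω hω
  have h3 : Summable fun k => ‖z k ω‖₊ := ENNReal.tsum_coe_ne_top_iff_summable.1 hω.ne
  simpa using NNReal.summable_coe.2 h3

lemma IsCylindricalFBM.measurable_noiseCoeff {H : ℝ} {β : ℕ → ℝ≥0 → Ω → ℝ}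
    (hβ : IsCylindricalFBM H β P) (h : ℝ≥0) (n k : ℕ) :
    Measurable fun ω => noiseCoeff β h n ω k :=
  (((hβ.fbm k).measurable _).sub ((hβ.fbm k).measurable _)).const_mul _

/-- The L¹ norm is at most the L² norm, which carries the summable factor e^{-λₖh}. The bound
degenerates as h → 0 and is used only qualitatively, to give the series a meaning. -/
lemma IsCylindricalFBM.ae_summable_noiseCoeff [IsProbabilityMeasure P] {H : ℝ} (hH : 0 < H)
    {β : ℕ → ℝ≥0 → Ω → ℝ} (hβ : IsCylindricalFBM H β P) {h : ℝ≥0} (hh : 0 < h) :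
    ∀ᵐ ω ∂P, ∀ n, Summable fun k => |noiseCoeff β h n ω k| := by
  have hh' : (0 : ℝ) < h := hh
  refine ae_all_iff.2 fun n => ?_
  refine ae_summable_abs_of_lintegral_le (hβ.measurable_noiseCoeff h n)
    (fun k => by positivity) ((summable_exp_neg_eigenvalue hh').mul_right
      (|((((n + 1 : ℕ) : ℝ≥0) * h : ℝ≥0) : ℝ) - ((n : ℝ≥0) * h : ℝ≥0)| ^ H)) fun k => ?_
  have h1 := (hβ.fbm k).eLpNorm_increment hH (((n + 1 : ℕ) : ℝ≥0) * h) ((n : ℝ≥0) * h)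
  have h2 := eLpNorm_const_smul (Real.exp (-eigenvalue k * h))
    (fun ω => β k (((n + 1 : ℕ) : ℝ≥0) * h) ω - β k ((n : ℝ≥0) * h) ω) 2 P
  rw [h1, Real.enorm_of_nonneg (Real.exp_pos _).le, ← ENNReal.ofReal_mul (Real.exp_pos _).le] at h2
  rw [← eLpNorm_one_eq_lintegral_enorm]
  exact (eLpNorm_le_eLpNorm_of_exponent_le one_le_two
    (hβ.measurable_noiseCoeff h n k).aestronglyMeasurable).trans h2.le

lemma eigenvalue_rpow_neg_le {H : ℝ} (hH : 0 ≤ H) (k : ℕ) :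
    eigenvalue k ^ (-H) ≤ ((k : ℝ) + 1) ^ (-(2 * H)) := by
  have h := Real.rpow_le_rpow_of_nonpos (by positivity) (sq_le_eigenvalue k) (neg_nonpos.2 hH)
  refine h.trans_eq ?_
  rw [← Real.rpow_natCast, ← Real.rpow_mul (by positivity)]
  congr 1
  push_cast
  ring

end Probability

/-! ### Moment bounds for the convolution and for the scheme. -/

/-- Uniform moment bounds, in the supremum norm, for the discrete stochastic convolution. -/
theorem exists_eLpNorm_convCoeff_le {H : ℝ} (hH : 1 / 4 < H) (hH1 : H ≤ 1) (r : ℕ) :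
    ∃ M : ℝ, 0 ≤ M ∧ ∀ (Ω : Type*) [MeasurableSpace Ω] (P : Measure Ω) [IsProbabilityMeasure P]
      (β : ℕ → ℝ≥0 → Ω → ℝ), IsCylindricalFBM H β P → ∀ h : ℝ≥0, 0 < h → ∀ n : ℕ,
      eLpNorm (fun ω => sineSeries (convCoeff β h n ω)) r P ≤ ENNReal.ofReal M := by
  -- Coefficients of size 6λₖ^{-H} decay with exponent α = 2H, and α > 1/2 is exactly H > 1/4.
  obtain ⟨M, hM, hbound⟩ := exists_eLpNorm_sineSeries_le (α := 2 * H) (c := 6) (by linarith)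
    (by norm_num) r
  refine ⟨M, hM, fun Ω _ P _ β hβ h hh n => ?_⟩
  refine hbound Ω P (fun k ω => convCoeff β h n ω k) (hβ.iIndepFun_discreteConv _ h n)
    (fun k => ?_) ?_
  · refine hasSubgaussianMGF_mono ((hβ.fbm k).hasSubgaussianMGF_discreteConv (by linarith) hH1
      (eigenvalue_pos k) h n) (Real.toNNReal_le_toNNReal ?_)
    have h1 := eigenvalue_rpow_neg_le (by linarith : (0 : ℝ) ≤ H) k
    have h2 : 0 ≤ eigenvalue k ^ (-H) := Real.rpow_nonneg (eigenvalue_pos k).le _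
    gcongr
  · filter_upwards [hβ.ae_summable_noiseCoeff (by linarith) hh] with ω hω
    exact summable_convCoeff hω n

/-- The L^p norm of an m-th power is the m-th power of the L^{pm} norm, to which Minkowski applies;
hence moments of order pm are needed. -/
lemma eLpNorm_one_add_norm_pow_le {Ω : Type*} [MeasurableSpace Ω] {P : Measure Ω}
    [IsProbabilityMeasure P] {Z : Ω → CSpace} (hZ : AEStronglyMeasurable Z P) {m p : ℕ}
    (hm : 1 ≤ m) (hp : 1 ≤ p) {M : ℝ} (hM : 0 ≤ M)
    (h : eLpNorm Z (p * m : ℕ) P ≤ ENNReal.ofReal M) :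
    eLpNorm (fun ω => (1 + ‖Z ω‖) ^ m) p P ≤ ENNReal.ofReal ((1 + M) ^ m) := by
  have h1 := eLpNorm_norm_rpow (p := (p : ℝ≥0∞)) (μ := P) (fun ω => 1 + ‖Z ω‖)
    (by exact_mod_cast hm : (0 : ℝ) < m)
  have h2 : (fun ω => ‖1 + ‖Z ω‖‖ ^ (m : ℝ)) = fun ω => (1 + ‖Z ω‖) ^ m := by
    ext ω
    rw [Real.norm_of_nonneg (by positivity), Real.rpow_natCast]
  rw [h2, ENNReal.ofReal_natCast, ← Nat.cast_mul, ENNReal.rpow_natCast] at h1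
  rw [h1, ENNReal.ofReal_pow (by positivity)]
  refine pow_le_pow_left₀ zero_le ?_ m
  have hpm : 1 ≤ p * m := Nat.one_le_iff_ne_zero.2 (by positivity)
  rw [ENNReal.ofReal_add zero_le_one hM]
  refine (eLpNorm_add_le (f := fun _ => (1 : ℝ)) aestronglyMeasurable_const hZ.norm
    (by exact_mod_cast hpm)).trans (add_le_add ?_ ?_)
  · rw [eLpNorm_const _ (by exact_mod_cast (by omega : p * m ≠ 0)) (IsProbabilityMeasure.ne_zero P)]
    simp
  · rwa [eLpNorm_norm]

/-- Pathwise bound of the numerical solution in terms of the discrete stochastic convolution. -/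
lemma norm_le_of_recursion {Ω : Type*} {f g : ℝ → ℝ} {T c K : ℝ} {m : ℕ} (hc : 0 ≤ c) (hK : 0 ≤ K)
    (hm : 1 ≤ m)
    (hstep : ∀ t, 0 < t → t ≤ T → ∀ x z : CSpace, ‖schemeStep f g t x - heat t z‖ ≤
        Real.exp (c * t) * ‖x - z‖ + t * (K * (1 + ‖z‖) ^ m))
    {β : ℕ → ℝ≥0 → Ω → ℝ} {h : ℝ≥0} (hh : 0 < h) {N : ℕ} (hN : 1 ≤ N) (hNT : N * (h : ℝ) = T)
    {x : ℕ → CSpace} {ω : Ω} (hω : ∀ n, Summable fun k => |noiseCoeff β h n ω k|)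
    (hx : ∀ n < N, x (n + 1) = schemeStep f g h (x n) + sineSeries (noiseCoeff β h n ω))
    {n : ℕ} (hn : n ≤ N) :
    ‖x n‖ ≤ Real.exp (c * T) * ‖x 0‖ +
      ∑ j ∈ Finset.range n, (Real.exp (c * T) * (h * K)) *
        (1 + ‖sineSeries (convCoeff β h j ω)‖) ^ m +
      (1 + ‖sineSeries (convCoeff β h n ω)‖) ^ m := by
  have hh' : (0 : ℝ) < h := hh
  have hN' : (1 : ℝ) ≤ N := by exact_mod_cast hN
  have hhT : (h : ℝ) ≤ T := by rw [← hNT]; exact le_mul_of_one_le_left hh'.le hN'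
  set Z : ℕ → CSpace := fun n => sineSeries (convCoeff β h n ω) with hZ
  have hZ0 : Z 0 = 0 := by
    have : convCoeff β h 0 ω = fun _ => 0 := rfl
    simp [hZ, this, sineSeries]
  have h1 := le_exp_mul_of_step (y := fun n => ‖x n - Z n‖) (ζ := fun n => (1 + ‖Z n‖) ^ m)
    (c := c) (h := h) (K := K) (N := N) (by positivity) (by positivity) (fun n => by positivity)
    (fun n hn => by
      have e : x (n + 1) - Z (n + 1) = schemeStep f g h (x n) - heat h (Z n) := by
        rw [hx n hn, hZ]
        simp only
        rw [sineSeries_convCoeff_succ hh hω n]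
        abel
      rw [e]
      exact hstep h hh' hhT (x n) (Z n)) hn
  simp only [hZ0, sub_zero] at h1
  have h2 : Real.exp (n * (c * h)) ≤ Real.exp (c * T) := by
    refine Real.exp_le_exp.2 ?_
    have : (n : ℝ) ≤ N := by exact_mod_cast hn
    calc (n : ℝ) * (c * h) = c * (n * h) := by ring
      _ ≤ c * (N * h) := by gcongr
      _ = c * T := by rw [hNT]
  have h3 : ‖x n‖ ≤ ‖x n - Z n‖ + ‖Z n‖ := by simpa using norm_add_le (x n - Z n) (Z n)
  -- The last value is also put in power form, so that a single moment bound covers every term.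
  have h4 : ‖Z n‖ ≤ (1 + ‖Z n‖) ^ m :=
    (le_add_of_nonneg_left zero_le_one).trans
      (le_self_pow₀ (by linarith [norm_nonneg (Z n)]) (by omega))
  rw [← Finset.mul_sum]
  calc ‖x n‖ ≤ Real.exp (n * (c * h)) *
        (‖x 0‖ + h * K * ∑ j ∈ Finset.range n, (1 + ‖Z j‖) ^ m) + (1 + ‖Z n‖) ^ m := by linarith
    _ ≤ Real.exp (c * T) *
        (‖x 0‖ + h * K * ∑ j ∈ Finset.range n, (1 + ‖Z j‖) ^ m) + (1 + ‖Z n‖) ^ m := by gcongr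
    _ = _ := by ring

section Scheme

variable {Ω : Type*} [MeasurableSpace Ω] {P : Measure Ω}

/-- The solution of the splitting scheme started at `x₀`. -/
def schemeSolution (f g : ℝ → ℝ) (h : ℝ≥0) (x₀ : CSpace) (β : ℕ → ℝ≥0 → Ω → ℝ) :
    ℕ → Ω → CSpace
  | 0, _ => x₀
  | n + 1, ω => schemeStep f g h (schemeSolution f g h x₀ β n ω) + sineSeries (noiseCoeff β h n ω)

lemma isNumericalSolution_schemeSolution [IsProbabilityMeasure P] {H : ℝ} (hH : 0 < H)
    {β : ℕ → ℝ≥0 → Ω → ℝ} (hβ : IsCylindricalFBM H β P) {h : ℝ≥0} (hh : 0 < h) (f g : ℝ → ℝ)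
    (N : ℕ) (x₀ : CSpace) :
    IsNumericalSolution f g h N x₀ β P (schemeSolution f g h x₀ β) where
  init := .of_forall fun _ => rfl
  step n _ := by
    filter_upwards [hβ.ae_summable_noiseCoeff hH hh] with ω hω
    exact (step_iff hh (hω n) _ _).2 rfl

lemma IsNumericalSolution.ae_recursion [IsProbabilityMeasure P] {H : ℝ} (hH : 0 < H)
    {β : ℕ → ℝ≥0 → Ω → ℝ} (hβ : IsCylindricalFBM H β P) {h : ℝ≥0} (hh : 0 < h) {f g : ℝ → ℝ}
    {N : ℕ} {x₀ : CSpace} {X : ℕ → Ω → CSpace} (hX : IsNumericalSolution f g h N x₀ β P X) :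
    ∀ᵐ ω ∂P, X 0 ω = x₀ ∧ (∀ n, Summable fun k => |noiseCoeff β h n ω k|) ∧
      ∀ n < N, X (n + 1) ω = schemeStep f g h (X n ω) + sineSeries (noiseCoeff β h n ω) := by
  have hsum := hβ.ae_summable_noiseCoeff hH hh
  have hstep : ∀ᵐ ω ∂P, ∀ n, n < N →
      X (n + 1) ω = schemeStep f g h (X n ω) + sineSeries (noiseCoeff β h n ω) := by
    refine ae_all_iff.2 fun n => ?_
    by_cases hn : n < N
    · filter_upwards [hX.step n hn, hsum] with ω hs hω _
      exact (step_iff hh (hω n) _ _).1 hs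
    · exact .of_forall fun _ h => absurd h hn
  filter_upwards [hX.init, hsum, hstep] with ω h0 hω hs using ⟨h0, hω, hs⟩

/-- A solution is not assumed measurable. Measurability propagates through the recursion, since the
deterministic step is continuous on C([0,1]). -/
lemma IsNumericalSolution.aestronglyMeasurable [IsProbabilityMeasure P] {H : ℝ} (hH : 0 < H)
    {β : ℕ → ℝ≥0 → Ω → ℝ} (hβ : IsCylindricalFBM H β P) {h : ℝ≥0} (hh : 0 < h) {f g : ℝ → ℝ}
    (hf : IsOneSidedLipschitz f) (hg : IsGloballyLipschitz g)
    {N : ℕ} {x₀ : CSpace} {X : ℕ → Ω → CSpace} (hX : IsNumericalSolution f g h N x₀ β P X)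
    {n : ℕ} (hn : n ≤ N) : AEStronglyMeasurable (X n) P := by
  have hrec := hX.ae_recursion hH hβ hh
  induction n with
  | zero =>
    exact (aestronglyMeasurable_const (b := x₀)).congr (hrec.mono fun ω hω => hω.1.symm)
  | succ n ih =>
    have h1 : AEStronglyMeasurable (fun ω => sineSeries (noiseCoeff β h n ω)) P :=
      aestronglyMeasurable_sineSeries (hβ.measurable_noiseCoeff h n)
        (hrec.mono fun ω hω => hω.2.1 n)
    have h2 := (continuous_schemeStep hf hg (t := h) hh).comp_aestronglyMeasurable (ih (by omega))
    exact (h2.add h1).congr (hrec.mono fun ω hω => (hω.2.2 n hn).symm)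

end Scheme

/-- Uniform moment bounds for the numerical solution. -/
theorem exists_eLpNorm_numericalSolution_le {H : ℝ} (hH : 1 / 4 < H) (hH1 : H ≤ 1) {f g : ℝ → ℝ}
    (hf : IsOneSidedLipschitz f) (hg : IsGloballyLipschitz g) {p : ℕ} (hp : 1 ≤ p) {T : ℝ}
    (hT : 0 < T) :
    ∃ C : ℝ → ℝ, (∀ r : ℝ, 0 < C r) ∧
      ∀ (Ω : Type*) [MeasurableSpace Ω] (P : Measure Ω) [IsProbabilityMeasure P]
        (β : ℕ → ℝ≥0 → Ω → ℝ), IsCylindricalFBM H β P →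
      ∀ (x₀ : CSpace) (N : ℕ) (h : ℝ≥0), 1 ≤ N → N * (h : ℝ) = T →
      ∀ X : ℕ → Ω → CSpace, IsNumericalSolution f g h N x₀ β P X → ∀ n ≤ N,
        eLpNorm (X n) p P ≤ ENNReal.ofReal (C ‖x₀‖) := by
  obtain ⟨c, K, m, hc, hK, hm, hstep⟩ := exists_norm_schemeStep_sub_le hf hg T
  obtain ⟨M, hM, hbound⟩ := exists_eLpNorm_convCoeff_le hH hH1 (p * m)
  set E := Real.exp (c * T) with hE
  have hE0 : 0 < E := Real.exp_pos _
  -- The absolute value keeps the constant positive for every real `r`, and it disappears at r =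
  -- ‖x₀‖.
  refine ⟨fun r => E * |r| + T * (E * K * (1 + M) ^ m) + (1 + M) ^ m, fun r => by positivity, ?_⟩
  intro Ω _ P _ β hβ x₀ N h hN hNT X hX n hn
  have hN' : (0 : ℝ) < N := by exact_mod_cast hN
  have hh' : (0 : ℝ) < h := pos_of_mul_pos_right (hNT ▸ hT) hN'.le
  have hh : 0 < h := hh'
  have hrec := hX.ae_recursion (by linarith) hβ hh
  have hp1 : (1 : ℝ≥0∞) ≤ p := by exact_mod_cast hp
  set ζ : ℕ → Ω → ℝ := fun j ω => (1 + ‖sineSeries (convCoeff β h j ω)‖) ^ m with hζ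
  have hZm : ∀ j, AEStronglyMeasurable (fun ω => sineSeries (convCoeff β h j ω)) P := fun j =>
    aestronglyMeasurable_sineSeries (fun k => (measurable_discreteConv _ j).comp
      (measurable_pi_lambda _ fun i => (hβ.fbm k).measurable _))
      (hrec.mono fun ω hω => summable_convCoeff hω.2.1 j)
  have hζm : ∀ j, AEStronglyMeasurable (ζ j) P := fun j =>
    (aestronglyMeasurable_const.add (hZm j).norm).pow m
  have hζle : ∀ j, eLpNorm (ζ j) p P ≤ ENNReal.ofReal ((1 + M) ^ m) := fun j =>
    eLpNorm_one_add_norm_pow_le (hZm j) hm hp hM (hbound Ω P β hβ h hh j)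
  set a : ℝ := E * (h * K) with ha
  have ha0 : 0 ≤ a := by positivity
  have haζm : ∀ j ∈ Finset.range n, AEStronglyMeasurable (a • ζ j) P := fun j _ =>
    (hζm j).const_smul a
  have hle : eLpNorm (X n) p P ≤
      eLpNorm ((fun _ => E * ‖x₀‖) + ∑ j ∈ Finset.range n, a • ζ j + ζ n) p P := by
    refine eLpNorm_mono_ae_real (hrec.mono fun ω hω => ?_)
    have := norm_le_of_recursion hc hK hm hstep hh hN hNT hω.2.1 (x := fun n => X n ω) hω.2.2 hn
    simp only [hω.1] at this
    simpa [hζ, ha] using this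
  have hconst : eLpNorm (fun _ : Ω => E * ‖x₀‖) p P = ENNReal.ofReal (E * |‖x₀‖|) := by
    rw [eLpNorm_const _ (by exact_mod_cast (by omega : p ≠ 0)) (IsProbabilityMeasure.ne_zero P),
      measure_univ, ENNReal.one_rpow, mul_one, Real.enorm_of_nonneg (by positivity), abs_norm]
  have hsum : eLpNorm (∑ j ∈ Finset.range n, a • ζ j) p P ≤
      ENNReal.ofReal (T * (E * K * (1 + M) ^ m)) := by
    refine (eLpNorm_sum_le haζm hp1).trans ?_
    refine (Finset.sum_le_card_nsmul _ _ (ENNReal.ofReal (a * (1 + M) ^ m)) fun j _ => ?_).trans ?_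
    · rw [eLpNorm_const_smul, Real.enorm_of_nonneg ha0, ENNReal.ofReal_mul ha0]
      gcongr
      exact hζle j
    · rw [Finset.card_range, nsmul_eq_mul, ← ENNReal.ofReal_natCast,
        ← ENNReal.ofReal_mul (by positivity)]
      refine ENNReal.ofReal_le_ofReal ?_
      have : (n : ℝ) ≤ N := by exact_mod_cast hn
      -- At most N terms of weight proportional to h add up to Nh = T, which makes the bound
      -- independent of the step size.
      calc (n : ℝ) * (a * (1 + M) ^ m) ≤ N * (a * (1 + M) ^ m) := by gcongr
        _ = (N * h) * (E * K * (1 + M) ^ m) := by rw [ha]; ring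
        _ = _ := by rw [hNT]
  refine hle.trans ((eLpNorm_add_le (aestronglyMeasurable_const.add
    (Finset.aestronglyMeasurable_sum _ haζm)) (hζm n) hp1).trans ?_)
  rw [ENNReal.ofReal_add (by positivity) (by positivity),
    ENNReal.ofReal_add (by positivity) (by positivity)]
  refine add_le_add ((eLpNorm_add_le aestronglyMeasurable_const
    (Finset.aestronglyMeasurable_sum _ haζm) hp1).trans (add_le_add hconst.le hsum)) (hζle n)

end SplittingScheme

end

theorem mainTheorem7
    (H : ℝ) (hH : H ∈ Set.Ioo (1 / 4 : ℝ) (1 / 2) ∪ Set.Ioo (1 / 2 : ℝ) 1)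
    (f g : ℝ → ℝ) (hf : SplittingScheme.IsOneSidedLipschitz f)
    (hg : SplittingScheme.IsGloballyLipschitz g)
    (p : ℕ) (hp : 1 ≤ p) (T : ℝ≥0) (hT : 0 < T) :
    ∃ C : ℝ → ℝ, (∀ r : ℝ, 0 < C r) ∧
      ∀ (Ω : Type*) [MeasurableSpace Ω] (P : Measure Ω) [IsProbabilityMeasure P]
        (β : ℕ → ℝ≥0 → Ω → ℝ), SplittingScheme.IsCylindricalFBM H β P →
      ∀ (x₀ : SplittingScheme.CSpace) (N : ℕ), 1 ≤ N →
        (∃ X : ℕ → Ω → SplittingScheme.CSpace,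
          SplittingScheme.IsNumericalSolution f g (T / N) N x₀ β P X) ∧
        ∀ X : ℕ → Ω → SplittingScheme.CSpace,
          SplittingScheme.IsNumericalSolution f g (T / N) N x₀ β P X →
          ∀ n ≤ N, MemLp (X n) p P ∧
            (∫ ω, ‖X n ω‖ ^ p ∂P) ^ (1 / (p : ℝ)) ≤ C ‖x₀‖ := by
  have hH0 : 1 / 4 < H ∧ H ≤ 1 := by
    rcases hH with ⟨h1, h2⟩ | ⟨h1, h2⟩ <;> constructor <;> linarith
  obtain ⟨C, hC, hbound⟩ :=
    SplittingScheme.exists_eLpNorm_numericalSolution_le hH0.1 hH0.2 hf hg hp (T := T) hT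
  refine ⟨C, hC, fun Ω _ P _ β hβ x₀ N hN => ?_⟩
  have hHpos : 0 < H := by linarith [hH0.1]
  have hN0 : (0 : ℝ≥0) < N := by exact_mod_cast hN
  have hh : 0 < T / (N : ℝ≥0) := div_pos hT hN0
  have hNT : (N : ℝ) * ((T / (N : ℝ≥0) : ℝ≥0) : ℝ) = T := by
    have h1 : (N : ℝ≥0) * (T / N) = T := mul_div_cancel₀ T hN0.ne'
    exact_mod_cast congrArg NNReal.toReal h1
  refine ⟨⟨_, SplittingScheme.isNumericalSolution_schemeSolution hHpos hβ hh f g N x₀⟩,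
    fun X hX n hn => ?_⟩
  have hle := hbound Ω P β hβ x₀ N _ hN hNT X hX n hn
  have hmem : MemLp (X n) p P :=
    ⟨hX.aestronglyMeasurable hHpos hβ hh hf hg hn, hle.trans_lt ENNReal.ofReal_lt_top⟩
  refine ⟨hmem, ?_⟩
  rwa [SplittingScheme.eLpNorm_natCast_eq hp hmem,
    ENNReal.ofReal_le_ofReal_iff (hC _).le] at hle
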